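/- **Theorem 1.** Fix integers $d\ge 0$, $K\ge 1$, $n\ge 0$, hyper-parameters $\lambda>0$, $\sigma_0\ge 0$, $\sigma>0$ known to the agent, and contexts $\mathbf x_{i,t}\in\mathbb R^d$ with $\|\mathbf x_{i,t}\|\le L$ for all arms $i\in[K]$ and rounds $t\in[n]$. Let $\boldsymbol\theta\sim\mathcal N(\mathbf 0,\lambda^{-1}\mathbf I_d)$, $v_i\sim\mathcal N(0,\sigma_0^2)$ and $\epsilon_{i,t}\sim\mathcal N(0,\sigma^2)$ be independent. In round $t$ the agent pulls an arm $I_t$, based on the contexts and on the arms and rewards of the earlier rounds, and observes the reward $r_{I_t,t}$, where $r_{i,t}=\mu_{i,t}+\epsilon_{i,t}$ and $\mu_{i,t}=\mathbf x_{i,t}^\top\boldsymbol\theta+v_i$. The $n$-round Bayes regret is $R(n)=\mathbb E\big[\sum_{t=1}^n(\max_{i}\mu_{i,t}-\mu_{I_t,t})\big]$. Before round $t$, let $\mathcal T_{i,t}$ be the set of earlier rounds in which arm $i$ was pulled, $n_{i,t}=|\mathcal T_{i,t}|$, $\bar r_{i,t}$ and $\bar{\mathbf x}_{i,t}$ the averages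 of $r_{i,\ell}$ and $\mathbf x_{i,\ell}$ over $\ell\in\mathcal T_{i,t}$, and $w_{i,t}=\sigma_0^2/(\sigma_0^2+\sigma^2/n_{i,t})$ (with $w_{i,t}=0$ if $n_{i,t}=0$). Put $$\mathbf M_t=\lambda\mathbf I_d+\sigma^{-2}\sum_{i=1}^K\Big(\sum_{\ell\in\mathcal T_{i,t}}\mathbf x_{i,\ell}\mathbf x_{i,\ell}^\top-w_{i,t}n_{i,t}\bar{\mathbf x}_{i,t}\bar{\mathbf x}_{i,t}^\top\Big),\qquad \hat{\boldsymbol\theta}_t=\mathbf M_t^{-1}\sigma^{-2}\sum_{i=1}^K\Big(\sum_{\ell\in\mathcal T_{i,t}}r_{i,\ell}\mathbf x_{i,\ell}-w_{i,t}n_{i,t}\bar r_{i,t}\bar{\mathbf x}_{i,t}\Big),$$ $$\hat\mu_{i,t}=w_{i,t}\bar r_{i,t}+\mathbf a_{i,t}^\top\hat{\boldsymbol\theta}_t,\qquad \tau_{i,t}^2=\sigma_0^2(1-w_{i,t})+\mathbf a_{i,t}^\top\mathbf M_t^{-1}\mathbf a_{i,t},\qquad \mathbf a_{i,t}=\mathbf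 x_{i,t}-w_{i,t}\bar{\mathbf x}_{i,t}.$$ Both algorithms pull $I_t=\operatorname{argmax}_{i}U_{i,t}$, ties being broken by an arbitrary measurable rule that is a function of $t$ and $(U_{i,t})_i$. RoLinUCB uses $U_{i,t}=\hat\mu_{i,t}+\sqrt{2\tau_{i,t}^2\log n}$. RoLinTS uses a posterior sample $U_{i,t}\sim\mathcal N(\hat\mu_{i,t},\tau_{i,t}^2)$, obtained by sampling the model parameters from their posterior: $U_{i,t}=\hat\mu_{i,t}+\mathbf a_{i,t}^\top\mathbf M_t^{-1/2}\boldsymbol\zeta_t+\sqrt{\sigma_0^2(1-w_{i,t})}\,\xi_{i,t}$ with standard normal $\boldsymbol\zeta_t\in\mathbb R^d$, $\xi_{i,t}\in\mathbb R$, independent of each other and of everything else. Then, for RoLinUCB as well as for RoLinTS, the expectation defining $R(n)$ exists and $$R(n)\le\sigma_{\max}\sqrt{2c(d+K)n\log n}+\sqrt{2/\pi}\,\sigma_{\max}K,$$ where $$\sigma_{\max}^2=\sigma_0^2+L^2\lambda^{-1},\qquad c=\log\Big(1+\frac{\sigma_{\max}^2n}{\sigma^2(d+K)}\Big)\Big/\log(1+\sigma^{-2}\sigma_{\max}^2)$$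 (for $\sigma_{\max}=0$ or $n=0$ the first term of the bound is $0$). -/

import Mathlib

open MeasureTheory ProbabilityTheory

namespace RobustBandit

noncomputable section

/-- Data of a robust contextual linear bandit with `K` arms and `d`-dimensional contexts: the
hyper-parameters `lam` (prior precision of `θ`), `σ0` (standard deviation of the arm effects `v i`),
`σ` (standard deviation of the reward noise), all known to the agent, and the contexts: `x t i` is
the feature vector of arm `i` in round `t`. Rounds are numbered `0, 1, 2, …`. -/
structure Model (d K : ℕ) where
  lam : ℝ
  σ0 : ℝ
  σ : ℝ
  x : ℕ → Fin K → EuclideanSpace ℝ (Fin d)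

/-! ### Sources of randomness -/

/-- Names of the independent real Gaussian variables that drive the model and the agents. -/
inductive Source (d K : ℕ) : Type
  /-- the `j`-th coordinate of `θ` -/
  | theta (j : Fin d)
  /-- the arm effect `v i` -/
  | effect (i : Fin K)
  /-- the reward noise of arm `i` in round `t` -/
  | noise (t : ℕ) (i : Fin K)
  /-- internal randomness of a posterior-sampling agent in round `t`, used for sampling `θ` -/
  | sampleTheta (t : ℕ) (j : Fin d)
  /-- internal randomness of a posterior-sampling agent in round `t`, used for sampling `v i` -/
  | sampleEffect (t : ℕ) (i : Fin K)

variable {d K : ℕ}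

/-- Variances: `θ ∼ N(0, lam⁻¹ I)`, `v i ∼ N(0, σ0 ^ 2)`, noise `∼ N(0, σ ^ 2)`; the internal
randomness of the agent is standard normal. -/
def Model.sourceVar (B : Model d K) : Source d K → ℝ
  | .theta _ => B.lam⁻¹
  | .effect _ => B.σ0 ^ 2
  | .noise _ _ => B.σ ^ 2
  | .sampleTheta _ _ => 1
  | .sampleEffect _ _ => 1

/-- `Z` is a realization, on the probability space `(Ω, P)`, of all sources of randomness:
independent centered Gaussian variables with the variances above. -/
structure Model.IsRealization (B : Model d K) {Ω : Type*} [MeasurableSpace Ω] (P : Measure Ω)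
    (Z : Source d K → Ω → ℝ) : Prop where
  measurable : ∀ s, Measurable (Z s)
  law : ∀ s, P.map (Z s) = gaussianReal 0 (B.sourceVar s).toNNReal
  indep : iIndepFun Z P

/-- Mean reward `μ_{i,t} = x_{i,t}ᵀ θ + v_i`. -/
def Model.meanReward (B : Model d K) (z : Source d K → ℝ) (t : ℕ) (i : Fin K) : ℝ :=
  (B.x t i).ofLp ⬝ᵥ (fun j => z (.theta j)) + z (.effect i)

/-- Reward `r_{i,t} = μ_{i,t} + ε_{i,t}`. -/
def Model.reward (B : Model d K) (z : Source d K → ℝ) (t : ℕ) (i : Fin K) : ℝ :=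
  B.meanReward z t i + z (.noise t i)

/-! ### Statistics of the agents

The history `h` at the beginning of round `t` lists, for every earlier round, the pulled arm and
the observed reward. (The contexts are known.) -/

/-- Histories at the beginning of round `t`. -/
abbrev History (K t : ℕ) : Type := Fin t → Fin K × ℝ

/-- Earlier rounds in which arm `i` was pulled. -/
def pulls {t : ℕ} (h : History K t) (i : Fin K) : Finset (Fin t) :=
  Finset.univ.filter (fun l => (h l).1 = i)

/-- Number of pulls `n_{i,t}`. -/
def count {t : ℕ} (h : History K t) (i : Fin K) : ℝ := ((pulls h i).card : ℝ)

/-- Average reward of arm `i` (only used with weight `0` if the arm has not been pulled). -/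
def avgReward {t : ℕ} (h : History K t) (i : Fin K) : ℝ :=
  (count h i)⁻¹ * ∑ l ∈ pulls h i, (h l).2

namespace Model

variable (B : Model d K) {t : ℕ} (h : History K t)

/-- Average context of the pulls of arm `i` (only used with weight `0` if the arm has not been
pulled). -/
def avgContext (i : Fin K) : Fin d → ℝ :=
  (count h i)⁻¹ • ∑ l ∈ pulls h i, (B.x l i).ofLp

/-- The weight `w_{i,t} = σ0 ^ 2 / (σ0 ^ 2 + σ ^ 2 / n_{i,t})`, with numerator and denominator
multiplied by `n_{i,t}` so that it is `0` for an arm that has not been pulled. -/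
def weight (i : Fin K) : ℝ :=
  count h i * B.σ0 ^ 2 / (count h i * B.σ0 ^ 2 + B.σ ^ 2)

/-- `M_t = lam I + σ⁻² ∑ i, (X_{i,t}ᵀ X_{i,t} - w_{i,t} n_{i,t} x̄_{i,t} x̄_{i,t}ᵀ)`. -/
def precision : Matrix (Fin d) (Fin d) ℝ :=
  B.lam • (1 : Matrix (Fin d) (Fin d) ℝ) + (B.σ ^ 2)⁻¹ • ∑ i : Fin K,
    ((∑ l ∈ pulls h i, Matrix.vecMulVec (B.x l i).ofLp (B.x l i).ofLp)
      - (B.weight h i * count h i) • Matrix.vecMulVec (B.avgContext h i) (B.avgContext h i))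

/-- The estimate `θ̂_t = M_t⁻¹ σ⁻² ∑ i, (X_{i,t}ᵀ r_{i,t} - w_{i,t} n_{i,t} r̄_{i,t} x̄_{i,t})`. -/
def thetaHat : Fin d → ℝ :=
  (B.precision h)⁻¹.mulVec ((B.σ ^ 2)⁻¹ • ∑ i : Fin K,
    ((∑ l ∈ pulls h i, (h l).2 • (B.x l i).ofLp)
      - (B.weight h i * count h i * avgReward h i) • B.avgContext h i))

/-- The calibrated context `x_{i,t} - w_{i,t} x̄_{i,t}`. -/
def calibContext (i : Fin K) : Fin d → ℝ :=
  (B.x t i).ofLp - B.weight h i • B.avgContext h i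

/-- The estimate `μ̂_{i,t} = w_{i,t} r̄_{i,t} + (x_{i,t} - w_{i,t} x̄_{i,t})ᵀ θ̂_t`. -/
def muHat (i : Fin K) : ℝ :=
  B.weight h i * avgReward h i + B.calibContext h i ⬝ᵥ B.thetaHat h

/-- The uncertainty `τ_{i,t}² = σ0² (1 - w_{i,t}) +
(x_{i,t} - w_{i,t} x̄_{i,t})ᵀ M_t⁻¹ (x_{i,t} - w_{i,t} x̄_{i,t})`. -/
def tauSq (i : Fin K) : ℝ :=
  B.σ0 ^ 2 * (1 - B.weight h i)
    + B.calibContext h i ⬝ᵥ (B.precision h)⁻¹.mulVec (B.calibContext h i)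

end Model

/-! ### The two algorithms -/

/-- An agent: the index `U_{i,t}` of every arm `i`, computed from the history at the beginning of
round `t` and (for a randomized agent) from the internal randomness. -/
abbrev Agent (d K : ℕ) : Type :=
  (t : ℕ) → History K t → (Source d K → ℝ) → Fin K → ℝ

/-- `RoLinUCB` with horizon `n`: `U_{i,t} = μ̂_{i,t} + √(2 τ_{i,t}² log n)`. -/
def Model.roLinUCB (B : Model d K) (n : ℕ) : Agent d K :=
  fun _ h _ i => B.muHat h i + Real.sqrt (2 * B.tauSq h i * Real.log n)

open scoped MatrixOrder in
/-- `RoLinTS`: `U_{i,t} ∼ N(μ̂_{i,t}, τ_{i,t}²)` is a posterior sample of `μ_{i,t}`, obtained by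
sampling the parameters `(θ, v)` from their posterior given the history,
`θ' = θ̂_t + M_t^{-1/2} ζ` and `v'_i = w_{i,t} (r̄_{i,t} - x̄_{i,t}ᵀ θ') + √(σ0² (1 - w_{i,t})) ξ_i` with
fresh standard normal `ζ`, `ξ`, and setting `U_{i,t} = x_{i,t}ᵀ θ' + v'_i`, that is,
`U_{i,t} = μ̂_{i,t} + (x_{i,t} - w_{i,t} x̄_{i,t})ᵀ M_t^{-1/2} ζ + √(σ0² (1 - w_{i,t})) ξ_i`. -/
def Model.roLinTS (B : Model d K) : Agent d K :=
  fun t h z i => B.muHat h i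
    + B.calibContext h i ⬝ᵥ
        (CFC.sqrt (B.precision h)⁻¹).mulVec (fun j => z (.sampleTheta t j))
    + Real.sqrt (B.σ0 ^ 2 * (1 - B.weight h i)) * z (.sampleEffect t i)

/-- `sel` is an argmax rule: in each round it returns an arm with the highest index, breaking ties
in an arbitrary measurable way. -/
structure IsArgmaxRule (sel : ℕ → (Fin K → ℝ) → Fin K) : Prop where
  measurable : ∀ t, Measurable (sel t)
  le : ∀ (t : ℕ) (u : Fin K → ℝ) (i : Fin K), u i ≤ u (sel t u)

namespace Model

variable (B : Model d K) (A : Agent d K) (sel : ℕ → (Fin K → ℝ) → Fin K) (z : Source d K → ℝ)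

/-- The history of agent `A`: in each round, the arm selected from the current indices is pulled
and its reward is observed. -/
def history : (t : ℕ) → History K t
  | 0 => Fin.elim0
  | t + 1 =>
    Fin.snoc (α := fun _ => Fin K × ℝ) (history t)
      (sel t (A t (history t) z), B.reward z t (sel t (A t (history t) z)))

/-- The arm `I_t` pulled by agent `A` in round `t`. -/
def pulledArm (t : ℕ) : Fin K := sel t (A t (B.history A sel z t) z)

/-- The realized regret over `n` rounds, `∑ t, (μ_{I_t^*,t} - μ_{I_t,t})`, where
`μ_{I_t^*,t}` is the highest mean reward in round `t`. Its expectation is the Bayes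
regret `R(n)`. -/
def regret (n : ℕ) : ℝ :=
  ∑ t ∈ Finset.range n, ((⨆ i, B.meanReward z t i) - B.meanReward z t (B.pulledArm A sel z t))

/-- `σ_max = √(σ0² + L² lam⁻¹)`. -/
def sigmaMax (L : ℝ) : ℝ := Real.sqrt (B.σ0 ^ 2 + L ^ 2 * B.lam⁻¹)

/-- `c = log (1 + σ_max² n / (σ² (d + K))) / log (1 + σ⁻² σ_max²)`. -/
def logConst (L : ℝ) (n : ℕ) : ℝ :=
  Real.log (1 + B.sigmaMax L ^ 2 * n / (B.σ ^ 2 * (d + K)))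
    / Real.log (1 + (B.σ ^ 2)⁻¹ * B.sigmaMax L ^ 2)

/-- The regret bound `σ_max √(2 c (d + K) n log n) + √(2 / π) σ_max K`. -/
def regretBound (L : ℝ) (n : ℕ) : ℝ :=
  B.sigmaMax L * Real.sqrt (2 * B.logConst L n * (d + K) * n * Real.log n)
    + Real.sqrt (2 / Real.pi) * B.sigmaMax L * K

end Model

end

end RobustBandit

/-!
The proof rests on one identity in law. For an agent whose arm is a function of the past history and
of fresh internal noise, the pair (history, parameters) has the same law as the pair (history,
posterior sample), where the posterior sample is an explicit affine function of standard normal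
noise that is independent of the history (`map_history_params`).

For this, the joint law of history and parameters has the likelihood of the observed rewards as its
density with respect to a product of the prior and some measure on histories
(`exists_history_law`, by induction on the round; the adaptive choice of the arms only affects that
measure). For a fixed history, "prior times likelihood" is a multiple of the law of the posterior
sample (`exists_lintegral_likelihood_eq`): in coordinates in which the prior is standard normal, the
exponent is a quadratic polynomial in the parameters, and the posterior sample is the affine change
of variables that turns it into `|ω|² / 2 + C`. These coordinates also cover `σ0 = 0`, where the
prior of the arm effects has no density.

Consequently, given the history, the deviation `μ - μ̂` of each arm is centered Gaussian with
variance `τ²` (`map_posteriorSample_sub`). Write `C = μ̂ + w` with `w = √(2 τ² log n)` for the upper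
confidence bound. With `j` the optimal and `i` the pulled arm, the regret of a round is
`(μ_j - C_j) + (C_j - C_i) + (C_i - μ_i)`.
* The first term is at most the sum over the arms of the excesses `(μ - C)⁺`, each of expectation at
  most `σ_max / (2 n)` (`integral_excess_le`). Over `n` rounds this gives `σ_max K / 2`, which is
  below `√(2 / π) σ_max K`.
* The second term has expectation at most `0`: for `RoLinUCB` because it maximizes `C`, for `RoLinTS`
  because the pulled arm and the optimal arm are the same function of a posterior sample and of the
  parameters, so that `C_i` and `C_j` have the same law (`map_history_posteriorSample`).
* The third term has the expectation of the width `w_i`, as `i` depends on the history and on noise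
  that is independent of the parameters (`integral_deviation_pulledArm`).

The widths of the pulled arms are summed with the Cauchy-Schwarz inequality and an elliptical
potential argument (`sum_tauSq_le`). The variance `τ²` is the quadratic form of the inverse of a
regularized Gram matrix in dimension `d + K`, whose feature vectors encode the context and the arm,
each scaled by its prior standard deviation (`exists_regularizedGram_mulVec_eq_feature`). Each round
multiplies the determinant of this matrix by one plus a multiple of `τ²`
(`det_regularizedGram_succ`), while the inequality of arithmetic and geometric means for its
eigenvalues bounds the determinant in terms of the trace (`log_det_regularizedGram_le`).
-/

namespace RobustBandit

open Matrix
open scoped ENNReal NNReal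

/-! ### Weights and the precision matrix -/

section Statistics

variable {d K t : ℕ} (B : Model d K) (h : History K t)

lemma count_nonneg (i : Fin K) : 0 ≤ count h i := Nat.cast_nonneg _

lemma count_mul_avg {E : Type*} [AddCommGroup E] [Module ℝ E] (i : Fin K) (f : Fin t → E) :
    count h i • ((count h i)⁻¹ • ∑ l ∈ pulls h i, f l) = ∑ l ∈ pulls h i, f l := by
  by_cases h0 : count h i = 0
  · have : pulls h i = ∅ := by simpa [count] using h0
    simp [this]
  · rw [smul_smul, mul_inv_cancel₀ h0, one_smul]

lemma count_mul_avgReward (i : Fin K) :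
    count h i * avgReward h i = ∑ l ∈ pulls h i, (h l).2 :=
  count_mul_avg h i fun l => (h l).2

lemma count_mul_avgContext_dotProduct (i : Fin K) (b : Fin d → ℝ) :
    count h i * (B.avgContext h i ⬝ᵥ b) = ∑ l ∈ pulls h i, (B.x l i).ofLp ⬝ᵥ b := by
  rw [← smul_eq_mul, ← smul_dotProduct, Model.avgContext, count_mul_avg, sum_dotProduct]

lemma sum_pulls {M : Type*} [AddCommMonoid M] (f : Fin t → Fin K → M) :
    ∑ i, ∑ l ∈ pulls h i, f l i = ∑ l, f l (h l).1 := by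
  simp only [pulls, Finset.sum_filter]
  rw [Finset.sum_comm]
  simp

section Weight

variable {B}

lemma weight_denom_pos (hσ : 0 < B.σ) (i : Fin K) : 0 < count h i * B.σ0 ^ 2 + B.σ ^ 2 :=
  add_pos_of_nonneg_of_pos (mul_nonneg (count_nonneg h i) (sq_nonneg _)) (pow_pos hσ 2)

lemma one_sub_weight (hσ : 0 < B.σ) (i : Fin K) :
    1 - B.weight h i = B.σ ^ 2 / (count h i * B.σ0 ^ 2 + B.σ ^ 2) := by
  have := (weight_denom_pos h hσ i).ne'
  rw [Model.weight]
  field_simp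
  ring

lemma one_sub_weight_pos (hσ : 0 < B.σ) (i : Fin K) : 0 < 1 - B.weight h i := by
  rw [one_sub_weight h hσ]
  exact div_pos (pow_pos hσ 2) (weight_denom_pos h hσ i)

end Weight

lemma precision_mulVec (b : Fin d → ℝ) :
    B.precision h *ᵥ b = B.lam • b + (B.σ ^ 2)⁻¹ • ∑ i,
      ((∑ l ∈ pulls h i, ((B.x l i).ofLp ⬝ᵥ b) • (B.x l i).ofLp)
        - (B.weight h i * count h i * (B.avgContext h i ⬝ᵥ b)) • B.avgContext h i) := by
  simp only [Model.precision, add_mulVec, smul_mulVec, one_mulVec, sum_mulVec, sub_mulVec,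
    vecMulVec_mulVec, op_smul_eq_smul, smul_smul]

lemma dotProduct_precision_mulVec (a b : Fin d → ℝ) :
    a ⬝ᵥ B.precision h *ᵥ b = B.lam * (a ⬝ᵥ b) + (B.σ ^ 2)⁻¹ * ∑ i,
      ((∑ l ∈ pulls h i, ((B.x l i).ofLp ⬝ᵥ a) * ((B.x l i).ofLp ⬝ᵥ b))
        - B.weight h i * count h i * (B.avgContext h i ⬝ᵥ a) * (B.avgContext h i ⬝ᵥ b)) := by
  simp only [precision_mulVec, dotProduct_add, dotProduct_smul, dotProduct_sum, dotProduct_sub,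
    smul_eq_mul]
  congr 3
  funext i
  congr 1
  · refine Finset.sum_congr rfl fun l _ => ?_
    rw [dotProduct_comm a]; ring
  · rw [dotProduct_comm a]; ring

variable {B} in
lemma precision_posDef (hlam : 0 < B.lam) (hσ : 0 < B.σ) : (B.precision h).PosDef := by
  refine Matrix.PosDef.of_dotProduct_mulVec_pos ?_ fun b hb => ?_
  · ext j k
    simp only [Model.precision, conjTranspose_apply, Matrix.add_apply, Matrix.smul_apply,
      Matrix.sum_apply, Matrix.sub_apply, vecMulVec_apply, one_apply, star_trivial,
      eq_comm (a := j) (b := k), mul_comm]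
  · rw [star_trivial, dotProduct_precision_mulVec]
    refine add_pos_of_pos_of_nonneg ?_ (mul_nonneg (by positivity) (Finset.sum_nonneg fun i _ => ?_))
    · refine mul_pos hlam ?_
      simpa using dotProduct_star_self_pos_iff.2 hb
    · have hw : B.weight h i ≤ 1 := by linarith [one_sub_weight_pos h hσ i]
      have hcs : (∑ l ∈ pulls h i, (B.x l i).ofLp ⬝ᵥ b) ^ 2
          ≤ count h i * ∑ l ∈ pulls h i, ((B.x l i).ofLp ⬝ᵥ b) ^ 2 := sq_sum_le_card_mul_sum_sq
      rw [← count_mul_avgContext_dotProduct] at hcs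
      have hn := count_nonneg h i
      rw [sub_nonneg]
      simp only [← sq]
      rw [mul_assoc _ (_ ⬝ᵥ _), ← sq]
      rcases hn.eq_or_lt with h0 | h0
      · rw [← h0]
        simpa using Finset.sum_nonneg fun (l : Fin t) _ => sq_nonneg ((B.x l i).ofLp ⬝ᵥ b)
      · have : count h i * (B.avgContext h i ⬝ᵥ b) ^ 2
            ≤ ∑ l ∈ pulls h i, ((B.x l i).ofLp ⬝ᵥ b) ^ 2 := by
          refine le_of_mul_le_mul_left ?_ h0
          linarith
        calc _ ≤ 1 * (count h i * (B.avgContext h i ⬝ᵥ b) ^ 2) := by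
              rw [mul_assoc]; gcongr
          _ ≤ _ := by rwa [one_mul]

end Statistics

/-! ### Posterior variance as a quadratic form, and the elliptical potential -/

section Potential

/-- The feature vector of arm `i` in round `t` for the rescaled parameters
`(√lam • θ, v / σ0) ∈ ℝ^(d + K)`, whose prior is standard normal. It makes sense for `σ0 = 0`. -/
noncomputable def Model.feature {d K : ℕ} (B : Model d K) (t : ℕ) (i : Fin K) :
    Fin d ⊕ Fin K → ℝ :=
  Sum.elim ((√B.lam)⁻¹ • (B.x t i).ofLp) (Pi.single i B.σ0)

/-- The precision matrix `1 + s⁻¹ ∑ l < t, ψ_l ψ_lᵀ` of a standard normal vector after `t`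
observations with features `ψ_l` and noise variance `s`. -/
noncomputable def regularizedGram {ι : Type*} [DecidableEq ι] (s : ℝ) (ψ : ℕ → ι → ℝ) (t : ℕ) :
    Matrix ι ι ℝ :=
  1 + s⁻¹ • ∑ l ∈ Finset.range t, vecMulVec (ψ l) (ψ l)

variable {ι : Type*} [DecidableEq ι] {s : ℝ} (ψ : ℕ → ι → ℝ)

lemma regularizedGram_succ (t : ℕ) :
    regularizedGram s ψ (t + 1) = regularizedGram s ψ t + s⁻¹ • vecMulVec (ψ t) (ψ t) := by
  simp [regularizedGram, Finset.sum_range_succ, smul_add, add_assoc]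

variable [Fintype ι]

lemma regularizedGram_mulVec (t : ℕ) (b : ι → ℝ) :
    regularizedGram s ψ t *ᵥ b = b + s⁻¹ • ∑ l ∈ Finset.range t, (ψ l ⬝ᵥ b) • ψ l := by
  simp only [regularizedGram, add_mulVec, one_mulVec, smul_mulVec, sum_mulVec, vecMulVec_mulVec,
    op_smul_eq_smul]

lemma dotProduct_regularizedGram_mulVec (t : ℕ) (b : ι → ℝ) :
    b ⬝ᵥ regularizedGram s ψ t *ᵥ b
      = b ⬝ᵥ b + s⁻¹ * ∑ l ∈ Finset.range t, (ψ l ⬝ᵥ b) ^ 2 := by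
  simp only [regularizedGram_mulVec, dotProduct_add, dotProduct_smul, dotProduct_sum, smul_eq_mul]
  congr 2
  refine Finset.sum_congr rfl fun l _ => ?_
  rw [dotProduct_comm b, sq]

lemma regularizedGram_posDef (hs : 0 < s) (t : ℕ) : (regularizedGram s ψ t).PosDef := by
  refine Matrix.PosDef.of_dotProduct_mulVec_pos ?_ fun b hb => ?_
  · ext j k
    simp only [regularizedGram, conjTranspose_apply, Matrix.add_apply, Matrix.smul_apply,
      Matrix.sum_apply, vecMulVec_apply, one_apply, star_trivial, eq_comm (a := j) (b := k), mul_comm]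
  · rw [star_trivial, dotProduct_regularizedGram_mulVec]
    refine add_pos_of_pos_of_nonneg ?_ (by positivity)
    simpa using dotProduct_star_self_pos_iff.2 hb

/-- Observations shrink the variance: `ψᵀ V⁻¹ ψ ≤ ‖ψ‖²`. -/
lemma dotProduct_le_of_regularizedGram_mulVec_eq (hs : 0 < s) {t : ℕ} {u φ : ι → ℝ}
    (hu : regularizedGram s ψ t *ᵥ u = φ) : φ ⬝ᵥ u ≤ φ ⬝ᵥ φ := by
  have h1 : u ⬝ᵥ u ≤ φ ⬝ᵥ u := by
    rw [dotProduct_comm φ, ← hu, dotProduct_regularizedGram_mulVec]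
    have : 0 ≤ s⁻¹ * ∑ l ∈ Finset.range t, (ψ l ⬝ᵥ u) ^ 2 := by positivity
    linarith
  have h2 : 0 ≤ (φ - u) ⬝ᵥ (φ - u) := by
    simpa using dotProduct_star_self_nonneg (φ - u)
  rw [sub_dotProduct, dotProduct_sub, dotProduct_sub, dotProduct_comm u φ] at h2
  linarith

/-- The matrix determinant lemma for one more observation. -/
lemma det_regularizedGram_succ {t : ℕ} {u : ι → ℝ}
    (hu : regularizedGram s ψ t *ᵥ u = ψ t) :
    (regularizedGram s ψ (t + 1)).det
      = (regularizedGram s ψ t).det * (1 + s⁻¹ * (ψ t ⬝ᵥ u)) := by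
  have hV : regularizedGram s ψ (t + 1)
      = regularizedGram s ψ t * (1 + replicateCol Unit u * replicateRow Unit (s⁻¹ • ψ t)) := by
    rw [regularizedGram_succ, mul_add, mul_one, ← Matrix.mul_assoc, ← replicateCol_mulVec, hu]
    congr 1
    ext j k
    simp [vecMulVec_apply, Matrix.mul_apply]
    ring
  rw [hV, det_mul, det_one_add_replicateCol_mul_replicateRow, smul_dotProduct, smul_eq_mul]

/-- The determinant is at most the power of the mean eigenvalue, which is the trace over the
dimension. -/
lemma log_det_regularizedGram_le (hs : 0 < s) [Nonempty ι] (n : ℕ) :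
    Real.log (regularizedGram s ψ n).det ≤ Fintype.card ι *
      Real.log (1 + (∑ l ∈ Finset.range n, ψ l ⬝ᵥ ψ l) / (s * Fintype.card ι)) := by
  have hV := regularizedGram_posDef ψ hs n
  have hc : (0 : ℝ) < Fintype.card ι := Nat.cast_pos.2 Fintype.card_pos
  set e := hV.isHermitian.eigenvalues with he
  have hpos : ∀ i, 0 < e i := hV.eigenvalues_pos
  have hdet : (regularizedGram s ψ n).det = ∏ i, e i := by
    simpa using hV.isHermitian.det_eq_prod_eigenvalues
  have htr : ∑ i, e i = Fintype.card ι + s⁻¹ * ∑ l ∈ Finset.range n, ψ l ⬝ᵥ ψ l := by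
    have h1 : (regularizedGram s ψ n).trace = ∑ i, e i := by
      simpa using hV.isHermitian.trace_eq_sum_eigenvalues
    rw [← h1]
    simp [regularizedGram, trace_add, trace_smul, trace_sum, trace_vecMulVec]
  set m : ℝ := (Fintype.card ι : ℝ)
  set a : ℝ := 1 + (∑ l ∈ Finset.range n, ψ l ⬝ᵥ ψ l) / (s * m) with ha
  have hsum : ∑ i, e i = m * a := by
    rw [htr, ha]
    field_simp
  have ha0 : 0 < a := by
    have : 0 < m * a := hsum ▸ Finset.sum_pos (fun i _ => hpos i) Finset.univ_nonempty
    exact pos_of_mul_pos_right this hc.le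
  rw [hdet, Real.log_prod fun i _ => (hpos i).ne']
  -- compare each eigenvalue with the mean `a` through `log y ≤ y - 1`
  have h1 : ∀ i, Real.log (e i) ≤ Real.log a + (e i / a - 1) := fun i => by
    have := Real.log_le_sub_one_of_pos (div_pos (hpos i) ha0)
    rw [Real.log_div (hpos i).ne' ha0.ne'] at this
    linarith
  calc ∑ i, Real.log (e i) ≤ ∑ i, (Real.log a + (e i / a - 1)) :=
        Finset.sum_le_sum fun i _ => h1 i
    _ = m * Real.log a := by
        rw [Finset.sum_add_distrib, Finset.sum_sub_distrib, ← Finset.sum_div, hsum]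
        simp only [Finset.sum_const, Finset.card_univ, nsmul_eq_mul, mul_one]
        field_simp
        ring

end Potential

section TauSq

variable {d K t : ℕ} {B : Model d K}

lemma feature_dotProduct_self (hlam : 0 < B.lam) (t : ℕ) (i : Fin K) :
    B.feature t i ⬝ᵥ B.feature t i = ‖B.x t i‖ ^ 2 * B.lam⁻¹ + B.σ0 ^ 2 := by
  have h1 : (B.x t i).ofLp ⬝ᵥ (B.x t i).ofLp = ‖B.x t i‖ ^ 2 := by
    rw [EuclideanSpace.real_norm_sq_eq]
    simp [dotProduct, sq]
  have h2 : (√B.lam)⁻¹ * (√B.lam)⁻¹ = B.lam⁻¹ := by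
    rw [← mul_inv, Real.mul_self_sqrt hlam.le]
  simp only [Model.feature, sumElim_dotProduct_sumElim, smul_dotProduct, dotProduct_smul,
    smul_eq_mul, h1, single_dotProduct, Pi.single_eq_same]
  rw [← mul_assoc, h2]
  ring

/-- The formula for `τ²`, which marginalizes the arm effects out, is the quadratic form
`ψᵀ V⁻¹ ψ` of the joint posterior covariance of `(θ, v)`; the vector `u = V⁻¹ ψ` is explicit. -/
lemma exists_regularizedGram_mulVec_eq_feature (hlam : 0 < B.lam) (hσ : 0 < B.σ)
    (h : History K t) (I : ℕ → Fin K) (hI : ∀ l : Fin t, (h l).1 = I l) (i : Fin K) :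
    ∃ u, regularizedGram (B.σ ^ 2) (fun l => B.feature l (I l)) t *ᵥ u = B.feature t i ∧
      B.feature t i ⬝ᵥ u = B.tauSq h i := by
  set b := (B.precision h)⁻¹ *ᵥ B.calibContext h i with hb
  set κ : Fin K → ℝ := fun j => count h j * B.σ0 ^ 2 + B.σ ^ 2 with hκ
  have hκ0 : ∀ j, κ j ≠ 0 := fun j => (weight_denom_pos h hσ j).ne'
  have hl : 0 < √B.lam := Real.sqrt_pos.2 hlam
  have hl2 : √B.lam * √B.lam = B.lam := Real.mul_self_sqrt hlam.le
  have hw : ∀ j, B.weight h j = count h j * B.σ0 ^ 2 / κ j := fun j => rfl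
  -- the arm-effect part of `u`, by solving the last `K` equations of `V u = ψ` for it
  obtain ⟨uv, huv⟩ : ∃ uv : Fin K → ℝ, ∀ j, uv j =
      -(count h j * B.σ0 / κ j * (B.avgContext h j ⬝ᵥ b))
        + if j = i then B.σ0 * B.σ ^ 2 / κ j else 0 := ⟨_, fun _ => rfl⟩
  have hMb : B.precision h *ᵥ b = B.calibContext h i := by
    have hdet : IsUnit (B.precision h).det :=
      (precision_posDef h hlam hσ).det_pos.ne'.isUnit
    rw [hb, mulVec_mulVec, mul_nonsing_inv _ hdet, one_mulVec]
  have hdot : ∀ (l : ℕ) (j : Fin K), B.feature l j ⬝ᵥ Sum.elim (√B.lam • b) uv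
      = (B.x l j).ofLp ⬝ᵥ b + B.σ0 * uv j := fun l j => by
    simp only [Model.feature, sumElim_dotProduct_sumElim, smul_dotProduct, dotProduct_smul,
      smul_eq_mul, single_dotProduct]
    field_simp
  refine ⟨Sum.elim (√B.lam • b) uv, ?_, ?_⟩
  · rw [regularizedGram_mulVec, Finset.sum_range]
    simp only [← hI]
    rw [← sum_pulls h fun l j => (B.feature l j ⬝ᵥ Sum.elim (√B.lam • b) uv) • B.feature l j]
    simp only [hdot]
    have hs := pow_pos hσ 2
    ext (k | j)
    · have hk := congrFun hMb k
      rw [precision_mulVec] at hk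
      simp only [Pi.add_apply, Pi.smul_apply, smul_eq_mul, Finset.sum_apply, Pi.sub_apply,
        Model.calibContext] at hk
      simp only [Pi.add_apply, Pi.smul_apply, smul_eq_mul, Finset.sum_apply, Model.feature,
        Sum.elim_inl]
      have hj : ∀ j, ∑ l ∈ pulls h j, ((B.x l j).ofLp ⬝ᵥ b + B.σ0 * uv j) *
            ((√B.lam)⁻¹ * (B.x l j).ofLp k)
          = (√B.lam)⁻¹ * ((∑ l ∈ pulls h j, ((B.x l j).ofLp ⬝ᵥ b) * (B.x l j).ofLp k
            - B.weight h j * count h j * (B.avgContext h j ⬝ᵥ b) * B.avgContext h j k)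
            + if j = i then B.σ ^ 2 * (B.weight h j * B.avgContext h j k) else 0) := fun j => by
        have hav : ∑ l ∈ pulls h j, (B.x l j).ofLp k = count h j * B.avgContext h j k := by
          have := congrFun (count_mul_avg h j fun l : Fin t => (B.x l j).ofLp) k
          simpa [Model.avgContext] using this.symm
        calc _ = (√B.lam)⁻¹ * (∑ l ∈ pulls h j, ((B.x l j).ofLp ⬝ᵥ b) * (B.x l j).ofLp k
              + B.σ0 * uv j * ∑ l ∈ pulls h j, (B.x l j).ofLp k) := by
              rw [mul_add, Finset.mul_sum, Finset.mul_sum, Finset.mul_sum,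
                ← Finset.sum_add_distrib]
              exact Finset.sum_congr rfl fun l _ => by ring
          _ = _ := by
              rw [hav, huv, hw]
              have := hκ0 j
              split_ifs <;> field_simp <;> ring
      simp only [hj, ← Finset.mul_sum, Finset.sum_add_distrib, Finset.sum_ite_eq',
        Finset.mem_univ, if_true]
      have hx : (B.x t i).ofLp k = B.lam * b k + (B.σ ^ 2)⁻¹ * ∑ j,
          (∑ l ∈ pulls h j, ((B.x l j).ofLp ⬝ᵥ b) * (B.x l j).ofLp k
            - B.weight h j * count h j * (B.avgContext h j ⬝ᵥ b) * B.avgContext h j k)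
          + B.weight h i * B.avgContext h i k := by linarith
      rw [hx]
      nth_rw 4 [← hl2]
      field_simp
      ring
    · simp only [Pi.add_apply, Pi.smul_apply, smul_eq_mul, Finset.sum_apply, Model.feature,
        Sum.elim_inr]
      have hj : ∀ j', ∑ l ∈ pulls h j', ((B.x l j').ofLp ⬝ᵥ b + B.σ0 * uv j') *
            (Pi.single j' B.σ0 : Fin K → ℝ) j
          = if j = j' then (count h j * (B.avgContext h j ⬝ᵥ b) + count h j * (B.σ0 * uv j))
            * B.σ0 else 0 := fun j' => by
        by_cases hjj : j = j'
        · subst hjj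
          rw [if_pos rfl, Pi.single_eq_same, ← Finset.sum_mul, Finset.sum_add_distrib,
            count_mul_avgContext_dotProduct]
          simp [count]
        · simp [hjj]
      simp only [hj, Finset.sum_ite_eq, Finset.mem_univ, if_true]
      have := hκ0 j
      have hk : κ j = count h j * B.σ0 ^ 2 + B.σ ^ 2 := rfl
      by_cases hji : j = i
      · subst hji
        simp only [huv, if_true, Pi.single_eq_same]
        field_simp
        rw [hk]
        ring
      · simp only [huv, if_neg hji, Pi.single_eq_of_ne hji]
        field_simp
        rw [hk]
        ring
  · rw [hdot, Model.tauSq, one_sub_weight h hσ, ← hb, Model.calibContext, sub_dotProduct,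
      smul_dotProduct, smul_eq_mul, huv, hw]
    have := hκ0 i
    simp only [if_true]
    change _ = B.σ0 ^ 2 * (B.σ ^ 2 / κ i) + _
    field_simp
    ring

lemma sigmaMax_sq (hlam : 0 < B.lam) (L : ℝ) :
    B.sigmaMax L ^ 2 = B.σ0 ^ 2 + L ^ 2 * B.lam⁻¹ :=
  Real.sq_sqrt (by positivity)

lemma feature_dotProduct_self_le (hlam : 0 < B.lam) {L : ℝ} {t : ℕ} {i : Fin K}
    (hx : ‖B.x t i‖ ≤ L) : B.feature t i ⬝ᵥ B.feature t i ≤ B.sigmaMax L ^ 2 := by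
  rw [feature_dotProduct_self hlam, sigmaMax_sq hlam, add_comm]
  gcongr

lemma tauSq_nonneg (hlam : 0 < B.lam) (hσ : 0 < B.σ) (h : History K t) (i : Fin K) :
    0 ≤ B.tauSq h i := by
  have h1 := (precision_posDef h hlam hσ).inv.posSemidef.dotProduct_mulVec_nonneg
    (B.calibContext h i)
  rw [star_trivial] at h1
  exact add_nonneg (mul_nonneg (sq_nonneg _) (one_sub_weight_pos h hσ i).le) h1

lemma tauSq_le_sigmaMax_sq (hlam : 0 < B.lam) (hσ : 0 < B.σ) {L : ℝ} (h : History K t)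
    {i : Fin K} (hx : ‖B.x t i‖ ≤ L) : B.tauSq h i ≤ B.sigmaMax L ^ 2 := by
  obtain ⟨u, hu, hτ⟩ := exists_regularizedGram_mulVec_eq_feature hlam hσ h
    (fun l => if hl : l < t then (h ⟨l, hl⟩).1 else i) (fun l => by simp) i
  rw [← hτ]
  exact (dotProduct_le_of_regularizedGram_mulVec_eq _ (pow_pos hσ 2) hu).trans
    (feature_dotProduct_self_le hlam hx)

/-- Bernoulli's inequality: a quantity in `[0, m]` is controlled by its logarithmic increment. -/
lemma mul_log_one_add_le {s m y : ℝ} (hs : 0 < s) (hy : 0 ≤ y) (hym : y ≤ m) :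
    y * Real.log (1 + s⁻¹ * m) ≤ m * Real.log (1 + s⁻¹ * y) := by
  have hm : 0 ≤ m := hy.trans hym
  rcases hm.eq_or_lt with rfl | hm
  · simp [le_antisymm hym hy]
  have hb : (1 + s⁻¹ * m) ^ (y / m) ≤ 1 + y / m * (s⁻¹ * m) :=
    rpow_one_add_le_one_add_mul_self (by linarith [mul_pos (inv_pos.2 hs) hm])
      (by positivity) ((div_le_one hm).2 hym)
  have h1 : 1 + y / m * (s⁻¹ * m) = 1 + s⁻¹ * y := by field_simp
  rw [h1] at hb
  have h2 := Real.log_le_log (by positivity) hb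
  rw [Real.log_rpow (by positivity)] at h2
  calc y * Real.log (1 + s⁻¹ * m) = m * (y / m * Real.log (1 + s⁻¹ * m)) := by field_simp
    _ ≤ _ := by gcongr

/-- The elliptical potential bound, valid for every sequence of pulls. -/
lemma sum_tauSq_le (hlam : 0 < B.lam) (hσ : 0 < B.σ) {L : ℝ} {n : ℕ}
    (hx : ∀ t < n, ∀ i, ‖B.x t i‖ ≤ L) (I : ℕ → Fin K) (h : ∀ t, History K t)
    (hI : ∀ t (l : Fin t), (h t l).1 = I l) :
    ∑ t ∈ Finset.range n, B.tauSq (h t) (I t)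
      ≤ B.sigmaMax L ^ 2 * (B.logConst L n * (d + K)) := by
  have hs : 0 < B.σ ^ 2 := pow_pos hσ 2
  have hKpos : 0 < K := (I 0).pos
  set ψ : ℕ → Fin d ⊕ Fin K → ℝ := fun l => B.feature l (I l) with hψ
  have hτ0 : ∀ t, 0 ≤ B.tauSq (h t) (I t) := fun t => tauSq_nonneg hlam hσ _ _
  have hτm : ∀ t < n, B.tauSq (h t) (I t) ≤ B.sigmaMax L ^ 2 := fun t ht =>
    tauSq_le_sigmaMax_sq hlam hσ _ (hx t ht _)
  have hdet : ∀ t, Real.log (regularizedGram (B.σ ^ 2) ψ (t + 1)).det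
      - Real.log (regularizedGram (B.σ ^ 2) ψ t).det
      = Real.log (1 + (B.σ ^ 2)⁻¹ * B.tauSq (h t) (I t)) := fun t => by
    obtain ⟨u, hu, hτ⟩ :=
      exists_regularizedGram_mulVec_eq_feature hlam hσ (h t) I (hI t) (I t)
    rw [det_regularizedGram_succ ψ hu, ← hτ, Real.log_mul]
    · ring
    · exact (regularizedGram_posDef ψ hs t).det_pos.ne'
    · have := mul_nonneg (inv_pos.2 hs).le (hτ ▸ hτ0 t)
      change 1 + (B.σ ^ 2)⁻¹ * (B.feature t (I t) ⬝ᵥ u) ≠ 0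
      linarith
  have hpot : ∑ t ∈ Finset.range n, Real.log (1 + (B.σ ^ 2)⁻¹ * B.tauSq (h t) (I t))
      ≤ (d + K) * Real.log (1 + B.sigmaMax L ^ 2 * n / (B.σ ^ 2 * (d + K))) := by
    simp only [← hdet]
    rw [Finset.sum_range_sub fun t => Real.log (regularizedGram (B.σ ^ 2) ψ t).det]
    have h0 : Real.log (regularizedGram (B.σ ^ 2) ψ 0).det = 0 := by simp [regularizedGram]
    have : Nonempty (Fin d ⊕ Fin K) := ⟨Sum.inr (I 0)⟩
    have h1 := log_det_regularizedGram_le ψ hs n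
    have hcard : (Fintype.card (Fin d ⊕ Fin K) : ℝ) = d + K := by simp
    have hdK : (0 : ℝ) < d + K := by positivity
    have hsum : ∑ l ∈ Finset.range n, ψ l ⬝ᵥ ψ l ≤ B.sigmaMax L ^ 2 * n := by
      refine (Finset.sum_le_card_nsmul _ _ (B.sigmaMax L ^ 2) fun l hl => ?_).trans
        (by simp [mul_comm])
      exact feature_dotProduct_self_le hlam (hx l (Finset.mem_range.1 hl) _)
    have hsum0 : 0 ≤ ∑ l ∈ Finset.range n, ψ l ⬝ᵥ ψ l :=
      Finset.sum_nonneg fun l _ => by simpa using dotProduct_star_self_nonneg (ψ l)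
    rw [h0, sub_zero]
    rw [hcard] at h1
    refine h1.trans ?_
    gcongr
  rcases (sq_nonneg (B.sigmaMax L)).eq_or_lt with hm | hm
  · rw [← hm, zero_mul]
    exact Finset.sum_nonpos fun t ht => hm ▸ hτm t (Finset.mem_range.1 ht)
  · have hlog : 0 < Real.log (1 + (B.σ ^ 2)⁻¹ * B.sigmaMax L ^ 2) :=
      Real.log_pos (by linarith [mul_pos (inv_pos.2 hs) hm])
    have key : (∑ t ∈ Finset.range n, B.tauSq (h t) (I t))
        * Real.log (1 + (B.σ ^ 2)⁻¹ * B.sigmaMax L ^ 2)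
        ≤ B.sigmaMax L ^ 2 *
          ((d + K) * Real.log (1 + B.sigmaMax L ^ 2 * n / (B.σ ^ 2 * (d + K)))) := by
      rw [Finset.sum_mul]
      refine le_trans (Finset.sum_le_sum fun t ht => ?_)
        ((Finset.mul_sum _ _ _).symm.le.trans (mul_le_mul_of_nonneg_left hpot hm.le))
      exact mul_log_one_add_le hs (hτ0 t) (hτm t (Finset.mem_range.1 ht))
    rw [← le_div_iff₀ hlog] at key
    refine key.trans (le_of_eq ?_)
    rw [Model.logConst]
    ring

end TauSq

/-! ### Bayes' rule for a fixed history -/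

section StandardGaussian

variable {ι : Type*} [Fintype ι]

/-- The standard Gaussian measure on `ι → ℝ`. -/
noncomputable def stdGaussianPi (ι : Type*) [Fintype ι] : Measure (ι → ℝ) :=
  Measure.pi fun _ => gaussianReal 0 1

instance : IsProbabilityMeasure (stdGaussianPi ι) := by
  unfold stdGaussianPi; infer_instance

/-- The density of `stdGaussianPi` up to its normalizing constant. -/
lemma stdGaussianPi_eq_withDensity : ∃ a : ℝ≥0∞, stdGaussianPi ι =
    (volume : Measure (ι → ℝ)).withDensity
      fun g => a * ENNReal.ofReal (Real.exp (-(g ⬝ᵥ g) / 2)) := by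
  set a : ℝ := ∏ _i : ι, (√(2 * Real.pi))⁻¹ with ha
  have hpdf : ∀ g : ι → ℝ, ∏ i, gaussianPDFReal 0 1 (g i) = a * Real.exp (-(g ⬝ᵥ g) / 2) := by
    intro g
    simp only [gaussianPDFReal, NNReal.coe_one, mul_one, sub_zero, Finset.prod_mul_distrib, ha,
      ← Real.exp_sum, dotProduct]
    rw [← Finset.sum_div, Finset.sum_neg_distrib]
    simp only [sq]
  refine ⟨ENNReal.ofReal a, ?_⟩
  have ha0 : 0 ≤ a := by positivity
  simp only [← ENNReal.ofReal_mul ha0, ← hpdf]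
  refine (Measure.pi_eq fun s hs => ?_)
  rw [withDensity_apply _ (MeasurableSet.univ_pi hs), ← lintegral_indicator (.univ_pi hs)]
  have hint : ∀ i, Integrable ((s i).indicator (gaussianPDFReal 0 1)) volume := fun i =>
    (integrable_gaussianPDFReal 0 1).indicator (hs i)
  have hnn : ∀ i x, 0 ≤ (s i).indicator (gaussianPDFReal 0 1) x := fun i x =>
    Set.indicator_nonneg (fun _ _ => gaussianPDFReal_nonneg _ _ _) _
  have h1 : ∀ g : ι → ℝ, (Set.univ.pi s).indicator
      (fun g => ENNReal.ofReal (∏ i, gaussianPDFReal 0 1 (g i))) g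
      = ENNReal.ofReal (∏ i, (s i).indicator (gaussianPDFReal 0 1) (g i)) := fun g => by
    by_cases hg : g ∈ Set.univ.pi s
    · rw [Set.indicator_of_mem hg]
      congr 1
      exact Finset.prod_congr rfl fun i _ => (Set.indicator_of_mem (hg i trivial) _).symm
    · rw [Set.indicator_of_notMem hg]
      simp only [Set.mem_pi, Set.mem_univ, true_implies, not_forall] at hg
      obtain ⟨i, hi⟩ := hg
      rw [Finset.prod_eq_zero (Finset.mem_univ i) (Set.indicator_of_notMem hi _),
        ENNReal.ofReal_zero]
  simp only [h1]
  rw [volume_pi, ← ofReal_integral_eq_lintegral_ofReal (Integrable.fintype_prod hint)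
    (ae_of_all _ fun g => Finset.prod_nonneg fun i _ => hnn i _),
    integral_fintype_prod_eq_prod, ENNReal.ofReal_prod_of_nonneg
      fun i _ => integral_nonneg (hnn i)]
  refine Finset.prod_congr rfl fun i _ => ?_
  rw [integral_indicator (hs i), gaussianReal_apply_eq_integral _ one_ne_zero]

/-- If reweighting the standard Gaussian density by `q` undoes, up to a constant, the invertible
affine map `ω ↦ b + A ω`, then the reweighted measure is a multiple of the law of `b + A ω`. -/
lemma exists_lintegral_mul_eq_of_affine [DecidableEq ι] (A : (ι → ℝ) →ₗ[ℝ] (ι → ℝ))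
    (hA : LinearMap.det A ≠ 0) (b : ι → ℝ) {q : (ι → ℝ) → ℝ≥0∞} (hq : Measurable q) {c₀ : ℝ≥0∞}
    (hc : ∀ ω, ENNReal.ofReal (Real.exp (-((b + A ω) ⬝ᵥ (b + A ω)) / 2)) * q (b + A ω)
      = c₀ * ENNReal.ofReal (Real.exp (-(ω ⬝ᵥ ω) / 2))) :
    ∃ c : ℝ≥0∞, ∀ F : (ι → ℝ) → ℝ≥0∞, Measurable F →
      ∫⁻ g, F g * q g ∂stdGaussianPi ι = c * ∫⁻ ω, F (b + A ω) ∂stdGaussianPi ι := by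
  obtain ⟨a, ha⟩ := stdGaussianPi_eq_withDensity (ι := ι)
  have hAm : Measurable A := (LinearMap.continuous_of_finiteDimensional A).measurable
  have hp : Measurable fun g : ι → ℝ => ENNReal.ofReal (Real.exp (-(g ⬝ᵥ g) / 2)) := by
    unfold dotProduct; fun_prop
  set k := ENNReal.ofReal |(LinearMap.det A)⁻¹| with hk
  have hk0 : k ≠ 0 := by simpa [hk] using hA
  have hkt : k ≠ ∞ := ENNReal.ofReal_ne_top
  have hvol : ∀ G : (ι → ℝ) → ℝ≥0∞, Measurable G →
      ∫⁻ g, G g = k⁻¹ * ∫⁻ ω, G (b + A ω) := fun G hG => by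
    have h1 : ∫⁻ ω, G (b + A ω) = k * ∫⁻ g, G g := by
      rw [← lintegral_add_left_eq_self G b, ← smul_eq_mul, ← lintegral_smul_measure,
        ← Real.map_linearMap_volume_pi_eq_smul_volume_pi hA, lintegral_map (by fun_prop) hAm]
    rw [h1, ← mul_assoc, ENNReal.inv_mul_cancel hk0 hkt, one_mul]
  refine ⟨k⁻¹ * c₀, fun F hF => ?_⟩
  rw [ha, lintegral_withDensity_eq_lintegral_mul _ (by fun_prop) (by fun_prop),
    lintegral_withDensity_eq_lintegral_mul _ (by fun_prop) (by fun_prop),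
    hvol _ (by fun_prop), mul_assoc]
  congr 1
  rw [← lintegral_const_mul _ (by fun_prop)]
  refine lintegral_congr fun ω => ?_
  simp only [Pi.mul_apply]
  calc _ = a * (ENNReal.ofReal (Real.exp (-((b + A ω) ⬝ᵥ (b + A ω)) / 2)) * q (b + A ω))
        * F (b + A ω) := by ring
    _ = _ := by rw [hc]; ring

end StandardGaussian

section Posterior

variable {d K t : ℕ} (B : Model d K) (h : History K t)

/-- The mean reward of arm `i` in round `l` under the parameters `β = (θ, v)`. -/
noncomputable def Model.armMean (β : Fin d ⊕ Fin K → ℝ) (l : ℕ) (i : Fin K) : ℝ :=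
  (B.x l i).ofLp ⬝ᵥ (fun j => β (.inl j)) + β (.inr i)

/-- The prior law of the parameters `(θ, v)`. -/
noncomputable def Model.prior : Measure (Fin d ⊕ Fin K → ℝ) :=
  Measure.pi fun k => gaussianReal 0
    ((Sum.elim (fun _ => B.lam⁻¹) (fun _ => B.σ0 ^ 2) k : ℝ)).toNNReal

instance : IsProbabilityMeasure B.prior := by
  unfold Model.prior; infer_instance

/-- The likelihood of the observed rewards under the parameters `β`, given the pulled arms. -/
noncomputable def Model.likelihood (β : Fin d ⊕ Fin K → ℝ) : ℝ≥0∞ :=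
  ∏ l : Fin t, gaussianPDF (B.armMean β l (h l).1) (B.σ ^ 2).toNNReal (h l).2

open scoped MatrixOrder in
/-- The posterior sample of `θ` computed from the standard normal vector `ω`. -/
noncomputable def Model.thetaSample (ω : Fin d ⊕ Fin K → ℝ) : Fin d → ℝ :=
  B.thetaHat h + CFC.sqrt (B.precision h)⁻¹ *ᵥ fun j => ω (.inl j)

/-- The posterior sample of the parameters `(θ, v)` computed from the standard normal vector
`ω`. -/
noncomputable def Model.posteriorSample (ω : Fin d ⊕ Fin K → ℝ) : Fin d ⊕ Fin K → ℝ :=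
  Sum.elim (B.thetaSample h ω) fun i =>
    B.weight h i * (avgReward h i - B.avgContext h i ⬝ᵥ B.thetaSample h ω)
      + √(B.σ0 ^ 2 * (1 - B.weight h i)) * ω (.inr i)

/-- `posteriorSample` in coordinates for which the prior is standard normal. Unlike
`posteriorSample` it is an invertible affine function of `ω` even if `σ0 = 0`. -/
noncomputable def Model.whitenedSample (ω : Fin d ⊕ Fin K → ℝ) : Fin d ⊕ Fin K → ℝ :=
  Sum.elim (√B.lam • B.thetaSample h ω) fun i =>
    count h i * B.σ0 / (count h i * B.σ0 ^ 2 + B.σ ^ 2)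
        * (avgReward h i - B.avgContext h i ⬝ᵥ B.thetaSample h ω)
      + √(1 - B.weight h i) * ω (.inr i)

/-- The change from coordinates with a standard normal prior to the parameters `(θ, v)`. -/
noncomputable def Model.unwhiten (g : Fin d ⊕ Fin K → ℝ) : Fin d ⊕ Fin K → ℝ :=
  Sum.elim (fun j => (√B.lam)⁻¹ * g (.inl j)) (fun i => B.σ0 * g (.inr i))

variable {B}

lemma unwhiten_whitenedSample (hlam : 0 < B.lam) (hσ0 : 0 ≤ B.σ0) (ω : Fin d ⊕ Fin K → ℝ) :
    B.unwhiten (B.whitenedSample h ω) = B.posteriorSample h ω := by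
  have hl : 0 < √B.lam := Real.sqrt_pos.2 hlam
  ext (j | i)
  · simp only [Model.unwhiten, Model.whitenedSample, Model.posteriorSample, Sum.elim_inl,
      Pi.smul_apply, smul_eq_mul]
    field_simp
  · simp only [Model.unwhiten, Model.whitenedSample, Model.posteriorSample, Sum.elim_inr,
      Real.sqrt_mul (sq_nonneg B.σ0), Real.sqrt_sq hσ0]
    rw [Model.weight]
    ring

lemma measurable_unwhiten : Measurable B.unwhiten := by
  refine measurable_pi_iff.2 fun k => ?_
  rcases k with j | i
  · simp only [Model.unwhiten, Sum.elim_inl]; fun_prop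
  · simp only [Model.unwhiten, Sum.elim_inr]; fun_prop

lemma map_unwhiten (hlam : 0 < B.lam) :
    (stdGaussianPi (Fin d ⊕ Fin K)).map B.unwhiten = B.prior := by
  have h1 : B.unwhiten = fun g k => (Sum.elim (fun _ => (√B.lam)⁻¹) (fun _ => B.σ0) k : ℝ) * g k := by
    ext g (j | i) <;> simp [Model.unwhiten]
  rw [h1, stdGaussianPi, Model.prior, Measure.pi_map_pi (by fun_prop)]
  congr 1
  funext k
  rw [gaussianReal_map_const_mul, mul_zero, mul_one]
  congr 1
  rcases k with j | i
  · ext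
    have : (√B.lam)⁻¹ ^ 2 = B.lam⁻¹ := by rw [inv_pow, Real.sq_sqrt hlam.le]
    simp [this, hlam.le]
  · ext
    simp [sq_nonneg]

lemma measurable_likelihood : Measurable (B.likelihood h) := by
  unfold Model.likelihood Model.armMean gaussianPDF gaussianPDFReal dotProduct
  fun_prop

section Sqrt

open scoped MatrixOrder

lemma transpose_sqrt_inv_precision : (CFC.sqrt (B.precision h)⁻¹)ᵀ = CFC.sqrt (B.precision h)⁻¹ := by
  have := (CFC.sqrt_nonneg (B.precision h)⁻¹).isSelfAdjoint
  rwa [IsSelfAdjoint, star_eq_conjTranspose, conjTranspose_eq_transpose_of_trivial] at this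

lemma sqrt_inv_precision_mul_self (hlam : 0 < B.lam) (hσ : 0 < B.σ) :
    CFC.sqrt (B.precision h)⁻¹ * CFC.sqrt (B.precision h)⁻¹ = (B.precision h)⁻¹ :=
  CFC.sqrt_mul_sqrt_self _ (precision_posDef h hlam hσ).inv.posSemidef.nonneg

lemma precision_mul_inv (hlam : 0 < B.lam) (hσ : 0 < B.σ) :
    B.precision h * (B.precision h)⁻¹ = 1 :=
  mul_nonsing_inv _ (precision_posDef h hlam hσ).det_pos.ne'.isUnit

/-- `M^(-1/2) M M^(-1/2) = 1`, as an identity of quadratic forms. -/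
lemma sqrt_inv_precision_quadratic (hlam : 0 < B.lam) (hσ : 0 < B.σ) (ζ : Fin d → ℝ) :
    (CFC.sqrt (B.precision h)⁻¹ *ᵥ ζ) ⬝ᵥ B.precision h *ᵥ (CFC.sqrt (B.precision h)⁻¹ *ᵥ ζ)
      = ζ ⬝ᵥ ζ := by
  set R := CFC.sqrt (B.precision h)⁻¹ with hR
  have h1 : R * (B.precision h * R) = 1 := by
    rw [mul_eq_one_comm, Matrix.mul_assoc, sqrt_inv_precision_mul_self h hlam hσ,
      precision_mul_inv h hlam hσ]
  rw [mulVec_mulVec, dotProduct_comm, dotProduct_mulVec, ← mulVec_transpose,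
    transpose_sqrt_inv_precision, ← hR, mulVec_mulVec, h1, one_mulVec]

/-- Sampling from `N(θ̂, M⁻¹)` turns the posterior quadratic form into the standard one. -/
lemma thetaSample_quadratic (hlam : 0 < B.lam) (hσ : 0 < B.σ) : ∃ C : ℝ, ∀ ω,
    B.lam * (B.thetaSample h ω ⬝ᵥ B.thetaSample h ω) + (B.σ ^ 2)⁻¹ * ∑ i,
      ((∑ l ∈ pulls h i, ((h l).2 - (B.x l i).ofLp ⬝ᵥ B.thetaSample h ω) ^ 2)
        - B.weight h i * count h i * (avgReward h i - B.avgContext h i ⬝ᵥ B.thetaSample h ω) ^ 2)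
      = (∑ j, ω (.inl j) ^ 2) + C := by
  refine ⟨(B.σ ^ 2)⁻¹ * ∑ i, ((∑ l ∈ pulls h i, (h l).2 ^ 2)
    - B.weight h i * count h i * avgReward h i ^ 2)
    - B.thetaHat h ⬝ᵥ B.precision h *ᵥ B.thetaHat h, fun ω => ?_⟩
  set θ := B.thetaSample h ω with hθ
  set ζ : Fin d → ℝ := fun j => ω (.inl j) with hζ
  -- the normal equations `M θ̂ = b`, tested against `θ`
  have hb : θ ⬝ᵥ B.precision h *ᵥ B.thetaHat h = (B.σ ^ 2)⁻¹ * ∑ i,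
      ((∑ l ∈ pulls h i, (h l).2 * ((B.x l i).ofLp ⬝ᵥ θ))
        - B.weight h i * count h i * avgReward h i * (B.avgContext h i ⬝ᵥ θ)) := by
    rw [Model.thetaHat, mulVec_mulVec, precision_mul_inv h hlam hσ, one_mulVec, dotProduct_comm]
    simp only [smul_dotProduct, sum_dotProduct, sub_dotProduct, smul_eq_mul]
  have hsq : θ ⬝ᵥ B.precision h *ᵥ θ - 2 * (θ ⬝ᵥ B.precision h *ᵥ B.thetaHat h)
      = ζ ⬝ᵥ ζ - B.thetaHat h ⬝ᵥ B.precision h *ᵥ B.thetaHat h := by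
    have hsymm : B.thetaHat h ⬝ᵥ B.precision h *ᵥ θ = θ ⬝ᵥ B.precision h *ᵥ B.thetaHat h := by
      rw [dotProduct_precision_mulVec, dotProduct_precision_mulVec, dotProduct_comm θ]
      congr 2
      refine Finset.sum_congr rfl fun i _ => ?_
      congr 1
      · exact Finset.sum_congr rfl fun l _ => mul_comm _ _
      · ring
    have hdiff : CFC.sqrt (B.precision h)⁻¹ *ᵥ ζ = θ - B.thetaHat h := by
      simp [hθ, Model.thetaSample, hζ]
    have := sqrt_inv_precision_quadratic h hlam hσ ζ
    rw [hdiff, mulVec_sub, dotProduct_sub, sub_dotProduct, sub_dotProduct, hsymm] at this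
    linarith
  have hexp : ∀ i, (∑ l ∈ pulls h i, ((h l).2 - (B.x l i).ofLp ⬝ᵥ θ) ^ 2)
        - B.weight h i * count h i * (avgReward h i - B.avgContext h i ⬝ᵥ θ) ^ 2
      = ((∑ l ∈ pulls h i, ((B.x l i).ofLp ⬝ᵥ θ) * ((B.x l i).ofLp ⬝ᵥ θ))
          - B.weight h i * count h i * (B.avgContext h i ⬝ᵥ θ) * (B.avgContext h i ⬝ᵥ θ))
        - 2 * ((∑ l ∈ pulls h i, (h l).2 * ((B.x l i).ofLp ⬝ᵥ θ))
          - B.weight h i * count h i * avgReward h i * (B.avgContext h i ⬝ᵥ θ))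
        + ((∑ l ∈ pulls h i, (h l).2 ^ 2) - B.weight h i * count h i * avgReward h i ^ 2) := by
    intro i
    have : ∑ l ∈ pulls h i, ((h l).2 - (B.x l i).ofLp ⬝ᵥ θ) ^ 2
        = (∑ l ∈ pulls h i, (h l).2 ^ 2) - 2 * (∑ l ∈ pulls h i, (h l).2 * ((B.x l i).ofLp ⬝ᵥ θ))
          + ∑ l ∈ pulls h i, ((B.x l i).ofLp ⬝ᵥ θ) * ((B.x l i).ofLp ⬝ᵥ θ) := by
      rw [Finset.mul_sum, ← Finset.sum_sub_distrib, ← Finset.sum_add_distrib]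
      exact Finset.sum_congr rfl fun l _ => by ring
    rw [this]
    ring
  have hM := dotProduct_precision_mulVec B h θ θ
  have hζζ : ζ ⬝ᵥ ζ = ∑ j, ω (.inl j) ^ 2 := by simp [dotProduct, hζ, sq]
  simp only [hexp, Finset.sum_add_distrib, Finset.sum_sub_distrib, ← Finset.mul_sum] at hb hM ⊢
  linear_combination hsq - hM + 2 * hb + hζζ

end Sqrt

/-- Completing the square: the log-density of the prior plus the log-likelihood, evaluated at a
posterior sample, is the log-density of the underlying noise up to a constant. -/
lemma whitenedSample_quadratic (hlam : 0 < B.lam) (hσ : 0 < B.σ) (hσ0 : 0 ≤ B.σ0) :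
    ∃ C : ℝ, ∀ ω, B.whitenedSample h ω ⬝ᵥ B.whitenedSample h ω + (B.σ ^ 2)⁻¹ *
        ∑ l : Fin t, ((h l).2 - B.armMean (B.posteriorSample h ω) l (h l).1) ^ 2
      = ω ⬝ᵥ ω + C := by
  obtain ⟨C, hC⟩ := thetaSample_quadratic h hlam hσ
  refine ⟨C, fun ω => ?_⟩
  have hs := pow_pos hσ 2
  obtain ⟨v, hv⟩ : ∃ v : Fin K → ℝ, v = fun i => B.whitenedSample h ω (.inr i) := ⟨_, rfl⟩
  have hθθ : B.whitenedSample h ω ⬝ᵥ B.whitenedSample h ω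
      = B.lam * (B.thetaSample h ω ⬝ᵥ B.thetaSample h ω) + ∑ i, v i ^ 2 := by
    have : B.whitenedSample h ω = Sum.elim (√B.lam • B.thetaSample h ω) v := by
      ext (j | i) <;> simp [hv, Model.whitenedSample]
    rw [this, sumElim_dotProduct_sumElim, smul_dotProduct, dotProduct_smul, smul_eq_mul,
      smul_eq_mul, ← mul_assoc, Real.mul_self_sqrt hlam.le]
    simp [dotProduct, sq]
  have hωω : ω ⬝ᵥ ω = (∑ j, ω (.inl j) ^ 2) + ∑ i, ω (.inr i) ^ 2 := by
    simp [dotProduct, sq]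
  have harm : ∀ l i, B.armMean (B.posteriorSample h ω) l i
      = (B.x l i).ofLp ⬝ᵥ B.thetaSample h ω + B.σ0 * v i := fun l i => by
    rw [← unwhiten_whitenedSample h hlam hσ0, hv]
    simp only [Model.armMean]
    congr 1
    congr 1
    ext j
    have hl : 0 < √B.lam := Real.sqrt_pos.2 hlam
    simp only [Model.unwhiten, Model.whitenedSample, Sum.elim_inl, Pi.smul_apply, smul_eq_mul]
    field_simp
  set θ := B.thetaSample h ω with hθ
  have hi : ∀ i, v i ^ 2 + (B.σ ^ 2)⁻¹ *
        ∑ l ∈ pulls h i, ((h l).2 - B.armMean (B.posteriorSample h ω) l i) ^ 2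
      = ω (.inr i) ^ 2 + (B.σ ^ 2)⁻¹ *
        ((∑ l ∈ pulls h i, ((h l).2 - (B.x l i).ofLp ⬝ᵥ θ) ^ 2)
          - B.weight h i * count h i * (avgReward h i - B.avgContext h i ⬝ᵥ θ) ^ 2) := fun i => by
    obtain ⟨ρ, hρ⟩ : ∃ ρ, ρ = avgReward h i - B.avgContext h i ⬝ᵥ θ := ⟨_, rfl⟩
    have hsum : ∑ l ∈ pulls h i, ((h l).2 - (B.x l i).ofLp ⬝ᵥ θ) = count h i * ρ := by
      rw [hρ, mul_sub, count_mul_avgReward, count_mul_avgContext_dotProduct,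
        Finset.sum_sub_distrib]
    have hsq : ∑ l ∈ pulls h i, ((h l).2 - B.armMean (B.posteriorSample h ω) l i) ^ 2
        = (∑ l ∈ pulls h i, ((h l).2 - (B.x l i).ofLp ⬝ᵥ θ) ^ 2)
          - 2 * (B.σ0 * v i) * (count h i * ρ) + count h i * (B.σ0 * v i) ^ 2 := by
      have hc : count h i * (B.σ0 * v i) ^ 2 = ∑ _l ∈ pulls h i, (B.σ0 * v i) ^ 2 := by
        simp [count]
      rw [← hsum, hc, Finset.mul_sum, ← Finset.sum_sub_distrib, ← Finset.sum_add_distrib]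
      exact Finset.sum_congr rfl fun l _ => by rw [harm]; ring
    obtain ⟨r, hr⟩ : ∃ r, r = √(1 - B.weight h i) := ⟨_, rfl⟩
    have hr2 : r ^ 2 = B.σ ^ 2 / (count h i * B.σ0 ^ 2 + B.σ ^ 2) := by
      rw [hr, Real.sq_sqrt (one_sub_weight_pos h hσ i).le, one_sub_weight h hσ]
    have hvi : v i = count h i * B.σ0 / (count h i * B.σ0 ^ 2 + B.σ ^ 2) * ρ
        + r * ω (.inr i) := by
      rw [hv, hρ, hr]; rfl
    have hw : B.weight h i = count h i * B.σ0 ^ 2 / (count h i * B.σ0 ^ 2 + B.σ ^ 2) := rfl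
    have hκ := (weight_denom_pos h hσ i).ne'
    rw [hsq, ← hρ, hw, hvi]
    generalize count h i = m at *
    generalize ω (.inr i) = ξ at *
    have hr3 : r ^ 2 * (m * B.σ0 ^ 2 + B.σ ^ 2) = B.σ ^ 2 := by rw [hr2]; field_simp
    generalize (∑ l ∈ pulls h i, ((h l).2 - (B.x l i).ofLp ⬝ᵥ θ) ^ 2) = S at *
    have hσ' := hσ.ne'
    field_simp
    linear_combination ξ ^ 2 * (m * B.σ0 ^ 2 + B.σ ^ 2) ^ 2 * hr3
  rw [hωω, hθθ, ← sum_pulls h fun l i =>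
    ((h l).2 - B.armMean (B.posteriorSample h ω) l i) ^ 2]
  have hsum := Finset.sum_congr (rfl : (Finset.univ : Finset (Fin K)) = Finset.univ)
    fun i _ => hi i
  simp only [Finset.sum_add_distrib, ← Finset.mul_sum] at hsum
  have := hC ω
  linear_combination hsum + this

/-- The linear part of `whitenedSample`. -/
noncomputable def whitenedSampleLinear (B : Model d K) (h : History K t) :
    (Fin d ⊕ Fin K → ℝ) →ₗ[ℝ] (Fin d ⊕ Fin K → ℝ) where
  toFun ω := B.whitenedSample h ω - B.whitenedSample h 0
  map_add' ω ω' := by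
    have h0 : (fun _ : Fin d => (0 : ℝ)) = 0 := rfl
    have h1 : (fun j : Fin d => ω (.inl j) + ω' (.inl j))
      = (fun j => ω (.inl j)) + fun j => ω' (.inl j) := rfl
    ext (j | i)
    · simp [Model.whitenedSample, Model.thetaSample, h0, h1, mulVec_add]
    · simp [Model.whitenedSample, Model.thetaSample, h0, h1, mulVec_add]
      ring
  map_smul' a ω := by
    have h0 : (fun _ : Fin d => (0 : ℝ)) = 0 := rfl
    have h1 : (fun j : Fin d => a * ω (.inl j)) = a • fun j => ω (.inl j) := rfl
    ext (j | i) <;>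
    · simp [Model.whitenedSample, Model.thetaSample, h0, h1, mulVec_smul]
      ring

open scoped MatrixOrder in
lemma det_whitenedSampleLinear_ne_zero (hlam : 0 < B.lam) (hσ : 0 < B.σ) :
    LinearMap.det (whitenedSampleLinear B h) ≠ 0 := by
  intro hdet
  obtain ⟨ω, hω, hω0⟩ := Submodule.exists_mem_ne_zero_of_ne_bot
    (LinearMap.bot_lt_ker_of_det_eq_zero hdet).ne'
  rw [LinearMap.mem_ker] at hω
  have hω' : B.whitenedSample h ω - B.whitenedSample h 0 = 0 := hω
  have hl : √B.lam ≠ 0 := (Real.sqrt_pos.2 hlam).ne'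
  have hθ : B.thetaSample h ω = B.thetaSample h 0 := by
    ext j
    have := congrFun hω' (.inl j)
    simpa [Model.whitenedSample, sub_eq_zero, hl] using this
  have hζ : (fun j => ω (.inl j)) = 0 := by
    have h1 : CFC.sqrt (B.precision h)⁻¹ *ᵥ (fun j => ω (.inl j)) = 0 := by
      have h0 : (fun _ : Fin d => (0 : ℝ)) = 0 := rfl
      simpa [Model.thetaSample, h0] using hθ
    have h2 := sqrt_inv_precision_quadratic h hlam hσ fun j => ω (.inl j)
    rw [h1, zero_dotProduct] at h2
    exact dotProduct_self_eq_zero.1 h2.symm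
  refine hω0 ?_
  ext (j | i)
  · exact congrFun hζ j
  · have := congrFun hω' (.inr i)
    have hr : √(1 - B.weight h i) ≠ 0 := (Real.sqrt_pos.2 (one_sub_weight_pos h hσ i)).ne'
    simpa [Model.whitenedSample, hθ, hr] using this

/-- Bayes' rule: weighting the prior with the likelihood of a history gives a multiple of the law
of the posterior sample. -/
lemma exists_lintegral_likelihood_eq (hlam : 0 < B.lam) (hσ : 0 < B.σ) (hσ0 : 0 ≤ B.σ0) :
    ∃ c : ℝ≥0∞, ∀ f : (Fin d ⊕ Fin K → ℝ) → ℝ≥0∞, Measurable f →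
      ∫⁻ β, B.likelihood h β * f β ∂B.prior
        = c * ∫⁻ ω, f (B.posteriorSample h ω) ∂stdGaussianPi (Fin d ⊕ Fin K) := by
  obtain ⟨C, hC⟩ := whitenedSample_quadratic h hlam hσ hσ0
  have hs := pow_pos hσ 2
  have hAb : ∀ ω, B.whitenedSample h 0 + whitenedSampleLinear B h ω = B.whitenedSample h ω :=
    fun ω => by simp [whitenedSampleLinear]
  set a : ℝ := ∏ _l : Fin t, (√(2 * Real.pi * B.σ ^ 2))⁻¹ with ha
  have ha0 : 0 ≤ a := by positivity
  have hlik : ∀ β, B.likelihood h β = ENNReal.ofReal (a * Real.exp (-((B.σ ^ 2)⁻¹ *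
      ∑ l : Fin t, ((h l).2 - B.armMean β l (h l).1) ^ 2) / 2)) := fun β => by
    simp only [Model.likelihood, gaussianPDF]
    rw [← ENNReal.ofReal_prod_of_nonneg fun l _ => gaussianPDFReal_nonneg _ _ _]
    simp only [gaussianPDFReal, Real.coe_toNNReal _ hs.le, Finset.prod_mul_distrib, ← ha,
      ← Real.exp_sum]
    congr 3
    rw [Finset.mul_sum, ← Finset.sum_neg_distrib, Finset.sum_div]
    refine Finset.sum_congr rfl fun l _ => ?_
    field_simp
  obtain ⟨c, hc⟩ := exists_lintegral_mul_eq_of_affine (whitenedSampleLinear B h)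
    (det_whitenedSampleLinear_ne_zero h hlam hσ) (B.whitenedSample h 0)
    (q := fun g => B.likelihood h (B.unwhiten g))
    ((measurable_likelihood h).comp measurable_unwhiten)
    (c₀ := ENNReal.ofReal (a * Real.exp (-C / 2))) (fun ω => by
      simp only [hAb, unwhiten_whitenedSample h hlam hσ0, hlik]
      rw [← ENNReal.ofReal_mul (Real.exp_nonneg _), ← ENNReal.ofReal_mul (by positivity)]
      congr 1
      calc _ = a * Real.exp (-(B.whitenedSample h ω ⬝ᵥ B.whitenedSample h ω + (B.σ ^ 2)⁻¹ *
            ∑ l : Fin t, ((h l).2 - B.armMean (B.posteriorSample h ω) l (h l).1) ^ 2) / 2) := by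
            rw [mul_left_comm, ← Real.exp_add]
            congr 2
            ring
        _ = _ := by
            rw [hC, mul_assoc, ← Real.exp_add]
            congr 2
            ring)
  refine ⟨c, fun f hf => ?_⟩
  rw [← map_unwhiten hlam,
    lintegral_map (f := fun β => B.likelihood h β * f β)
      ((measurable_likelihood h).mul hf) measurable_unwhiten]
  simp only [mul_comm (B.likelihood h _)]
  rw [hc (fun g => f (B.unwhiten g)) (hf.comp measurable_unwhiten)]
  simp only [hAb, unwhiten_whitenedSample h hlam hσ0]

end Posterior

/-! ### Measurability of the statistics -/

section Measurability

variable {d K t : ℕ} (B : Model d K)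

lemma measurable_select {X Y : Type*} [MeasurableSpace X] [MeasurableSpace Y]
    {f : Fin K → X → Y} (hf : ∀ i, Measurable (f i)) {J : X → Fin K} (hJ : Measurable J) :
    Measurable fun x => f (J x) x :=
  (measurable_from_prod_countable_right (f := fun p : Fin K × X => f p.1 p.2) hf).comp
    (hJ.prodMk measurable_id)

/-- The history with the observed rewards erased. -/
def History.arms (h : History K t) : History K t := fun l => ((h l).1, 0)

lemma pulls_arms (h : History K t) : pulls h.arms = pulls h := rfl

lemma count_arms (h : History K t) : count h.arms = count h := rfl

lemma weight_arms (h : History K t) : B.weight h.arms = B.weight h := by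
  funext i; simp only [Model.weight, count_arms]

lemma avgContext_arms (h : History K t) : B.avgContext h.arms = B.avgContext h := by
  funext i; simp only [Model.avgContext, count_arms, pulls_arms]

lemma precision_arms (h : History K t) : B.precision h.arms = B.precision h := by
  simp only [Model.precision, count_arms, pulls_arms, weight_arms, avgContext_arms]

lemma calibContext_arms (h : History K t) : B.calibContext h.arms = B.calibContext h := by
  funext i; simp only [Model.calibContext, weight_arms, avgContext_arms]

lemma tauSq_arms (h : History K t) : B.tauSq h.arms = B.tauSq h := by
  funext i; simp only [Model.tauSq, weight_arms, calibContext_arms, precision_arms]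

/-- A statistic that only depends on the pulled arms is measurable, because there are finitely many
sequences of arms. -/
lemma measurable_of_arms {Y : Type*} [MeasurableSpace Y] {f : History K t → Y}
    (hf : ∀ h, f h = f h.arms) : Measurable f := by
  have h1 : f = (fun a : Fin t → Fin K => f fun l => (a l, 0)) ∘ fun h l => (h l).1 :=
    funext hf
  rw [h1]
  exact Measurable.of_discrete.comp (by fun_prop)

lemma measurable_sum_pulls (i : Fin K) (c : Fin t → ℝ) :
    Measurable fun h : History K t => ∑ l ∈ pulls h i, (h l).2 * c l := by
  simp only [pulls, Finset.sum_filter]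
  refine Finset.measurable_sum _ fun l _ => Measurable.ite ?_ (by fun_prop) measurable_const
  exact measurableSet_eq_fun (by fun_prop) measurable_const

lemma measurable_avgReward (i : Fin K) :
    Measurable fun h : History K t => avgReward h i := by
  have h1 : Measurable fun h : History K t => (count h i)⁻¹ :=
    measurable_of_arms fun h => by rw [count_arms]
  have h2 := measurable_sum_pulls (t := t) i fun _ => 1
  simp only [mul_one] at h2
  exact h1.mul h2

lemma measurable_weight (i : Fin K) : Measurable fun h : History K t => B.weight h i :=
  measurable_of_arms fun h => by rw [weight_arms]

lemma measurable_tauSq (i : Fin K) : Measurable fun h : History K t => B.tauSq h i :=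
  measurable_of_arms fun h => by rw [tauSq_arms]

lemma measurable_thetaHat (j : Fin d) : Measurable fun h : History K t => B.thetaHat h j := by
  have h1 : ∀ k, Measurable fun h : History K t => (B.precision h)⁻¹ j k := fun k =>
    measurable_of_arms fun h => by rw [precision_arms]
  have h2 : ∀ k i, Measurable fun h : History K t =>
      B.weight h i * count h i * avgReward h i * B.avgContext h i k := fun k i => by
    have h3 : Measurable fun h : History K t => B.weight h i * count h i :=
      measurable_of_arms fun h => by rw [weight_arms, count_arms]
    have h4 : Measurable fun h : History K t => B.avgContext h i k :=
      measurable_of_arms fun h => by rw [avgContext_arms]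
    exact (h3.mul (measurable_avgReward i)).mul h4
  have h5 : ∀ k i, Measurable fun h : History K t =>
      ∑ l ∈ pulls h i, (h l).2 * (B.x l i).ofLp k := fun k i => measurable_sum_pulls i _
  simp only [Model.thetaHat, mulVec, dotProduct, Pi.smul_apply, Finset.sum_apply, Pi.sub_apply,
    smul_eq_mul]
  exact Finset.measurable_sum _ fun k _ => (h1 k).mul
    ((Finset.measurable_sum _ fun i _ => (h5 k i).sub (h2 k i)).const_mul _)

lemma measurable_muHat (i : Fin K) : Measurable fun h : History K t => B.muHat h i := by
  have h1 : ∀ j, Measurable fun h : History K t => B.calibContext h i j := fun j =>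
    measurable_of_arms fun h => by rw [calibContext_arms]
  have h2 := measurable_thetaHat (t := t) B
  have h3 := measurable_weight (t := t) B i
  have h4 := measurable_avgReward (t := t) i
  simp only [Model.muHat, dotProduct]
  fun_prop

open scoped MatrixOrder in
lemma measurable_thetaSample (j : Fin d) : Measurable
    fun p : History K t × (Fin d ⊕ Fin K → ℝ) => B.thetaSample p.1 p.2 j := by
  have h1 : ∀ k, Measurable fun h : History K t => CFC.sqrt (B.precision h)⁻¹ j k := fun k =>
    measurable_of_arms fun h => by rw [precision_arms]
  have h2 := measurable_thetaHat (t := t) B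
  simp only [Model.thetaSample, mulVec, dotProduct, Pi.add_apply]
  exact ((h2 j).comp measurable_fst).add (Finset.measurable_sum _ fun k _ =>
    ((h1 k).comp measurable_fst).mul (by fun_prop))

lemma measurable_posteriorSample : Measurable
    fun p : History K t × (Fin d ⊕ Fin K → ℝ) => B.posteriorSample p.1 p.2 := by
  have h1 := measurable_thetaSample (t := t) B
  refine measurable_pi_iff.2 fun k => ?_
  rcases k with j | i
  · exact h1 j
  · have h2 : ∀ k, Measurable fun h : History K t => B.avgContext h i k := fun k =>
      measurable_of_arms fun h => by rw [avgContext_arms]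
    have h3 : Measurable fun h : History K t => √(B.σ0 ^ 2 * (1 - B.weight h i)) :=
      measurable_of_arms fun h => by rw [weight_arms]
    have h4 := measurable_weight (t := t) B i
    have h5 := measurable_avgReward (t := t) i
    simp only [Model.posteriorSample, Sum.elim_inr, dotProduct]
    fun_prop

lemma measurable_armMean (l : ℕ) (i : Fin K) : Measurable fun β => B.armMean β l i := by
  unfold Model.armMean dotProduct
  fun_prop

lemma measurable_likelihood_prod : Measurable
    fun p : History K t × (Fin d ⊕ Fin K → ℝ) => B.likelihood p.1 p.2 := by
  have h1 : ∀ l : Fin t, Measurable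
      fun p : History K t × (Fin d ⊕ Fin K → ℝ) => B.armMean p.2 l (p.1 l).1 := fun l =>
    measurable_select (f := fun i (p : History K t × (Fin d ⊕ Fin K → ℝ)) => B.armMean p.2 l i)
      (fun i => (measurable_armMean B l i).comp measurable_snd) (by fun_prop)
  unfold Model.likelihood gaussianPDF gaussianPDFReal
  fun_prop

lemma measurable_snoc {X E : Type*} [MeasurableSpace X] [MeasurableSpace E] {f : X → Fin t → E}
    {g : X → E} (hf : Measurable f) (hg : Measurable g) :
    Measurable fun x => (Fin.snoc (α := fun _ => E) (f x) (g x) : Fin (t + 1) → E) := by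
  refine measurable_pi_iff.2 fun k => ?_
  refine Fin.lastCases ?_ (fun l => ?_) k
  · simpa using hg
  · simpa [Function.comp_def] using (measurable_pi_apply l).comp hf

end Measurability

/-! ### Independence of past and present randomness -/

section Sources

variable {d K : ℕ}

/-- The parameters `(θ, v)` as a function of the sources of randomness. -/
def params (z : Source d K → ℝ) : Fin d ⊕ Fin K → ℝ :=
  Sum.elim (fun j => z (.theta j)) (fun i => z (.effect i))

/-- The internal randomness of the agent in round `t`. -/
def internalNoise (t : ℕ) (z : Source d K → ℝ) : Fin d ⊕ Fin K → ℝ :=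
  Sum.elim (fun j => z (.sampleTheta t j)) (fun i => z (.sampleEffect t i))

/-- The sources that determine the parameters and the first `t` rounds. -/
def pastSources (t : ℕ) : Set (Source d K) :=
  {s | match s with
    | .theta _ => True
    | .effect _ => True
    | .noise l _ => l < t
    | .sampleTheta l _ => l < t
    | .sampleEffect l _ => l < t}

/-- The internal randomness of the agent in round `t`, as a set of sources. -/
def internalSources (t : ℕ) : Set (Source d K) :=
  {s | (∃ j, s = .sampleTheta t j) ∨ ∃ i, s = .sampleEffect t i}

/-- The reward noise of round `t`, as a set of sources. -/
def noiseSources (t : ℕ) : Set (Source d K) :=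
  {s | ∃ i, s = .noise t i}

lemma pastSources_mono {l t : ℕ} (h : l ≤ t) :
    (pastSources l : Set (Source d K)) ⊆ pastSources t := by
  rintro (_ | _ | _ | _ | _) hs
  · trivial
  · trivial
  all_goals exact lt_of_lt_of_le (show _ < l from hs) h

lemma internalSources_subset_pastSources (t : ℕ) :
    (internalSources t : Set (Source d K)) ⊆ pastSources (t + 1) := by
  rintro s (⟨j, rfl⟩ | ⟨i, rfl⟩) <;> exact Nat.lt_succ_self t

lemma noiseSources_subset_pastSources (t : ℕ) :
    (noiseSources t : Set (Source d K)) ⊆ pastSources (t + 1) := by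
  rintro s ⟨i, rfl⟩
  exact Nat.lt_succ_self t

lemma disjoint_pastSources (t : ℕ) :
    Disjoint (pastSources t : Set (Source d K)) (internalSources t ∪ noiseSources t) := by
  rw [Set.disjoint_left]
  rintro s hs ((⟨j, rfl⟩ | ⟨i, rfl⟩) | ⟨i, rfl⟩) <;> exact lt_irrefl t hs

lemma disjoint_internalSources (t : ℕ) :
    Disjoint (internalSources t : Set (Source d K)) (noiseSources t) := by
  rw [Set.disjoint_left]
  rintro s (⟨j, rfl⟩ | ⟨i, rfl⟩) ⟨i', hi⟩ <;> cases hi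

variable {Ω : Type*}

lemma measurable_params [MeasurableSpace Ω] {Z : Source d K → Ω → ℝ} {t : ℕ}
    (hZ : ∀ s ∈ pastSources t, Measurable (Z s)) :
    Measurable fun ω => params fun s => Z s ω := by
  refine measurable_pi_iff.2 fun k => ?_
  rcases k with j | i
  · exact hZ (.theta j) trivial
  · exact hZ (.effect i) trivial

lemma measurable_internalNoise [MeasurableSpace Ω] {Z : Source d K → Ω → ℝ} {t : ℕ}
    (hZ : ∀ s ∈ internalSources t, Measurable (Z s)) :
    Measurable fun ω => internalNoise t fun s => Z s ω := by
  refine measurable_pi_iff.2 fun k => ?_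
  rcases k with j | i
  · exact hZ (.sampleTheta t j) (.inl ⟨j, rfl⟩)
  · exact hZ (.sampleEffect t i) (.inr ⟨i, rfl⟩)

lemma measurable_noise [MeasurableSpace Ω] {Z : Source d K → Ω → ℝ} {t : ℕ}
    (hZ : ∀ s ∈ noiseSources t, Measurable (Z s)) :
    Measurable fun ω i => Z (.noise t i) ω :=
  measurable_pi_iff.2 fun i => hZ (.noise t i) ⟨i, rfl⟩

/-- The agent `A` computes its indices in round `t` from the history and from the internal
randomness of that round only, by the measurable function `a t`. -/
structure IsRoundwise (A : Agent d K)
    (a : (t : ℕ) → History K t → (Fin d ⊕ Fin K → ℝ) → Fin K → ℝ) : Prop where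
  eq : ∀ t h z, A t h z = a t h (internalNoise t z)
  measurable : ∀ t, Measurable fun p : History K t × (Fin d ⊕ Fin K → ℝ) => a t p.1 p.2

variable {B : Model d K} {A : Agent d K} {sel : ℕ → (Fin K → ℝ) → Fin K}
  {a : (t : ℕ) → History K t → (Fin d ⊕ Fin K → ℝ) → Fin K → ℝ}

lemma measurable_selected (hA : IsRoundwise A a) (hsel : IsArgmaxRule sel) (t : ℕ) :
    Measurable fun p : History K t × (Fin d ⊕ Fin K → ℝ) => sel t (a t p.1 p.2) :=
  (hsel.measurable t).comp (hA.measurable t)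

lemma meanReward_eq_armMean (z : Source d K → ℝ) (t : ℕ) (i : Fin K) :
    B.meanReward z t i = B.armMean (params z) t i := rfl

lemma history_succ (hA : IsRoundwise A a) (z : Source d K → ℝ) (t : ℕ) :
    B.history A sel z (t + 1) = Fin.snoc (α := fun _ => Fin K × ℝ) (B.history A sel z t)
      (sel t (a t (B.history A sel z t) (internalNoise t z)),
        B.armMean (params z) t (sel t (a t (B.history A sel z t) (internalNoise t z)))
          + z (.noise t (sel t (a t (B.history A sel z t) (internalNoise t z))))) := by
  rw [← hA.eq]
  rfl

lemma pulledArm_eq (hA : IsRoundwise A a) (z : Source d K → ℝ) (t : ℕ) :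
    B.pulledArm A sel z t = sel t (a t (B.history A sel z t) (internalNoise t z)) := by
  rw [← hA.eq]
  rfl

lemma history_apply_fst (A : Agent d K) (z : Source d K → ℝ) (t : ℕ) (l : Fin t) :
    (B.history A sel z t l).1 = B.pulledArm A sel z l := by
  induction t with
  | zero => exact l.elim0
  | succ t ih =>
    rw [Model.history]
    refine Fin.lastCases ?_ (fun l => ?_) l
    · simp [Model.pulledArm]
    · simpa using ih l

lemma measurable_history [MeasurableSpace Ω] (hA : IsRoundwise A a) (hsel : IsArgmaxRule sel)
    {Z : Source d K → Ω → ℝ} {t : ℕ} (hZ : ∀ s ∈ pastSources t, Measurable (Z s)) :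
    Measurable fun ω => B.history A sel (fun s => Z s ω) t := by
  induction t with
  | zero => exact measurable_pi_iff.2 fun l => l.elim0
  | succ t ih =>
    have hH := ih fun s hs => hZ s (pastSources_mono t.le_succ hs)
    have hζ := measurable_internalNoise (t := t) fun s hs =>
      hZ s (internalSources_subset_pastSources t hs)
    have hI := (measurable_selected hA hsel t).comp (hH.prodMk hζ)
    simp only [history_succ hA]
    refine measurable_snoc hH (hI.prodMk (Measurable.add ?_ ?_))
    · exact measurable_select (fun i => (measurable_armMean B t i).comp (measurable_params hZ)) hI
    · exact measurable_select (fun i => hZ (.noise t i)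
        (noiseSources_subset_pastSources t ⟨i, rfl⟩)) hI

section Independence

variable [MeasurableSpace Ω] {P : Measure Ω} {Z : Source d K → Ω → ℝ}

/-- Variables that depend on disjoint sets of sources are independent. That `f` depends only on the
sources in `S` is expressed by measurability for every σ-algebra that makes these measurable. -/
lemma indepFun_of_disjoint_sources {X Y : Type*} [MeasurableSpace X] [MeasurableSpace Y]
    (hZ : B.IsRealization P Z) {S T : Set (Source d K)} (hST : Disjoint S T) {f : Ω → X} {g : Ω → Y}
    (hf : ∀ m : MeasurableSpace Ω, (∀ s ∈ S, Measurable[m] (Z s)) → Measurable[m] f)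
    (hg : ∀ m : MeasurableSpace Ω, (∀ s ∈ T, Measurable[m] (Z s)) → Measurable[m] g) :
    IndepFun f g P := by
  have hm : ∀ S : Set (Source d K), ∀ s ∈ S,
      Measurable[⨆ s ∈ S, MeasurableSpace.comap (Z s) inferInstance] (Z s) := fun S s hs =>
    (comap_measurable (Z s)).mono
      (le_iSup₂ (f := fun s _ => MeasurableSpace.comap (Z s) inferInstance) s hs) le_rfl
  have h1 := indep_iSup_of_disjoint (fun s => (hZ.measurable s).comap_le) hZ.indep hST
  rw [IndepFun_iff_Indep]
  exact indep_of_indep_of_le_right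
    (indep_of_indep_of_le_left h1 (hf _ (hm S)).comap_le) (hg _ (hm T)).comap_le

lemma map_params [IsProbabilityMeasure P] (hZ : B.IsRealization P Z) :
    P.map (fun ω => params fun s => Z s ω) = B.prior := by
  have hinj : Function.Injective
      (Sum.elim Source.theta Source.effect : Fin d ⊕ Fin K → Source d K) := by
    rintro (j | i) (j' | i') hjj <;> cases hjj <;> rfl
  have h1 := (hZ.indep.precomp hinj).map_fun_eq_pi_map fun k => (hZ.measurable _).aemeasurable
  have h2 : (fun ω => params fun s => Z s ω)
      = fun ω k => Z (Sum.elim Source.theta Source.effect k) ω := by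
    ext ω (j | i) <;> rfl
  rw [h2, h1, Model.prior]
  congr 1
  funext k
  rw [hZ.law]
  rcases k with j | i <;> rfl

lemma map_internalNoise [IsProbabilityMeasure P] (hZ : B.IsRealization P Z) (t : ℕ) :
    P.map (fun ω => internalNoise t fun s => Z s ω) = stdGaussianPi (Fin d ⊕ Fin K) := by
  have hinj : Function.Injective
      (Sum.elim (Source.sampleTheta t) (Source.sampleEffect t) : Fin d ⊕ Fin K → Source d K) := by
    rintro (j | i) (j' | i') hjj <;> cases hjj <;> rfl
  have h1 := (hZ.indep.precomp hinj).map_fun_eq_pi_map fun k => (hZ.measurable _).aemeasurable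
  have h2 : (fun ω => internalNoise t fun s => Z s ω)
      = fun ω k => Z (Sum.elim (Source.sampleTheta t) (Source.sampleEffect t) k) ω := by
    ext ω (j | i) <;> rfl
  rw [h2, h1, stdGaussianPi]
  congr 1
  funext k
  rw [hZ.law]
  rcases k with j | i <;> simp [Model.sourceVar]

lemma map_noise [IsProbabilityMeasure P] (hZ : B.IsRealization P Z) (t : ℕ) :
    P.map (fun ω i => Z (.noise t i) ω)
      = Measure.pi fun _ : Fin K => gaussianReal 0 (B.σ ^ 2).toNNReal := by
  have hinj : Function.Injective (Source.noise t : Fin K → Source d K) := by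
    intro i i' hii; cases hii; rfl
  rw [(hZ.indep.precomp hinj).map_fun_eq_pi_map fun k => (hZ.measurable _).aemeasurable]
  congr 1
  funext i
  rw [hZ.law]
  rfl

variable [IsProbabilityMeasure P]

/-- The internal noise and the reward noise of round `t` are independent of each other and of the
pair of past history and parameters. -/
lemma map_history_params_noise (hA : IsRoundwise A a) (hsel : IsArgmaxRule sel)
    (hZ : B.IsRealization P Z) (t : ℕ) :
    P.map (fun ω => ((B.history A sel (fun s => Z s ω) t, params fun s => Z s ω),
        (internalNoise t fun s => Z s ω), fun i => Z (.noise t i) ω))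
      = (P.map fun ω => (B.history A sel (fun s => Z s ω) t, params fun s => Z s ω)).prod
        ((stdGaussianPi (Fin d ⊕ Fin K)).prod
          (Measure.pi fun _ : Fin K => gaussianReal 0 (B.σ ^ 2).toNNReal)) := by
  have hp : ∀ m : MeasurableSpace Ω, (∀ s ∈ pastSources t, Measurable[m] (Z s)) → Measurable[m]
      fun ω => (B.history A sel (fun s => Z s ω) t, params fun s => Z s ω) := fun m hm =>
    (measurable_history hA hsel hm).prodMk (measurable_params hm)
  have hi : ∀ m : MeasurableSpace Ω, (∀ s ∈ internalSources t, Measurable[m] (Z s)) →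
      Measurable[m] fun ω => internalNoise t fun s => Z s ω := fun m hm =>
    measurable_internalNoise hm
  have hn : ∀ m : MeasurableSpace Ω, (∀ s ∈ noiseSources t, Measurable[m] (Z s)) →
      Measurable[m] fun ω i => Z (.noise t i) ω := fun m hm => measurable_noise hm
  have h1 := (indepFun_of_disjoint_sources hZ (disjoint_pastSources t) hp fun m hm =>
    (hi m fun s hs => hm s (.inl hs)).prodMk (hn m fun s hs => hm s (.inr hs))).map_prod_eq_prod_map_map
    (hp _ fun s _ => hZ.measurable s).aemeasurable
    ((hi _ fun s _ => hZ.measurable s).prodMk (hn _ fun s _ => hZ.measurable s)).aemeasurable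
  have h2 := (indepFun_of_disjoint_sources hZ (disjoint_internalSources t) hi
    hn).map_prod_eq_prod_map_map (hi _ fun s _ => hZ.measurable s).aemeasurable
    (hn _ fun s _ => hZ.measurable s).aemeasurable
  rw [map_internalNoise hZ, map_noise hZ] at h2
  rw [h1, h2]

end Independence

end Sources

/-! ### Joint law of the history and the parameters -/

section PosteriorLaw

variable {d K : ℕ} {Ω : Type*} [MeasurableSpace Ω] {P : Measure Ω} [IsProbabilityMeasure P]
  {B : Model d K} {A : Agent d K} {sel : ℕ → (Fin K → ℝ) → Fin K}
  {a : (t : ℕ) → History K t → (Fin d ⊕ Fin K → ℝ) → Fin K → ℝ} {Z : Source d K → Ω → ℝ}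

lemma measurable_armMean_select {X : Type*} [MeasurableSpace X] {b : X → Fin d ⊕ Fin K → ℝ}
    (hb : Measurable b) {J : X → Fin K} (hJ : Measurable J) (t : ℕ) :
    Measurable fun x => B.armMean (b x) t (J x) :=
  measurable_select (f := fun i x => B.armMean (b x) t i)
    (fun i => (measurable_armMean B t i).comp hb) hJ

lemma likelihood_snoc {t : ℕ} (h : History K t) (i : Fin K) (y : ℝ) (β : Fin d ⊕ Fin K → ℝ) :
    B.likelihood (Fin.snoc (α := fun _ => Fin K × ℝ) h (i, y) : History K (t + 1)) β
      = B.likelihood h β * gaussianPDF (B.armMean β t i) (B.σ ^ 2).toNNReal y := by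
  simp [Model.likelihood, Fin.prod_univ_castSucc]

/-- The joint law of the history and the parameters has the likelihood as its density with respect
to a product of the prior and a measure `ρ` on histories. The adaptive choice of the arms only
enters into `ρ`. -/
lemma exists_history_law (hσ : 0 < B.σ) (hA : IsRoundwise A a) (hsel : IsArgmaxRule sel)
    (hZ : B.IsRealization P Z) (t : ℕ) :
    ∃ ρ : Measure (History K t), SFinite ρ ∧
      ∀ f : History K t × (Fin d ⊕ Fin K → ℝ) → ℝ≥0∞, Measurable f →
        ∫⁻ ω, f (B.history A sel (fun s => Z s ω) t, params fun s => Z s ω) ∂P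
          = ∫⁻ h, ∫⁻ β, B.likelihood h β * f (h, β) ∂B.prior ∂ρ := by
  have hβ : Measurable fun ω => params fun s => Z s ω :=
    measurable_params (t := 0) fun s _ => hZ.measurable s
  induction t with
  | zero =>
    refine ⟨Measure.dirac Fin.elim0, inferInstance, fun f hf => ?_⟩
    rw [lintegral_dirac, ← map_params hZ, lintegral_map _ hβ]
    · simp [Model.likelihood, Model.history]
    · exact (measurable_likelihood _).mul (by fun_prop)
  | succ t ih =>
    obtain ⟨ρ, hρ, ih⟩ := ih
    have hv : (B.σ ^ 2).toNNReal ≠ 0 := (Real.toNNReal_pos.2 (pow_pos hσ 2)).ne'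
    set γ := stdGaussianPi (Fin d ⊕ Fin K) with hγ
    set I : History K t × (Fin d ⊕ Fin K → ℝ) → Fin K := fun p => sel t (a t p.1 p.2) with hI
    have hIm : Measurable I := measurable_selected hA hsel t
    -- the next history, from the past history, the internal noise, and the new reward
    set φ : History K t × (Fin d ⊕ Fin K → ℝ) × ℝ → History K (t + 1) := fun p =>
      Fin.snoc (α := fun _ => Fin K × ℝ) p.1 (I (p.1, p.2.1), p.2.2) with hφ
    have hφm : Measurable φ :=
      measurable_snoc measurable_fst ((hIm.comp (by fun_prop)).prodMk (by fun_prop))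
    clear_value φ
    refine ⟨(ρ.prod (γ.prod volume)).map φ, inferInstance, fun f hf => ?_⟩
    set G : (History K t × (Fin d ⊕ Fin K → ℝ)) → ℝ≥0∞ := fun p =>
      ∫⁻ ζ, ∫⁻ y, gaussianPDF (B.armMean p.2 t (I (p.1, ζ))) (B.σ ^ 2).toNNReal y
        * f (φ (p.1, ζ, y), p.2) ∂volume ∂γ with hG
    have hpdf : Measurable fun p : ((History K t × (Fin d ⊕ Fin K → ℝ)) × (Fin d ⊕ Fin K → ℝ)) × ℝ =>
        gaussianPDF (B.armMean p.1.1.2 t (I (p.1.1.1, p.1.2))) (B.σ ^ 2).toNNReal p.2 := by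
      have : Measurable fun p : ((History K t × (Fin d ⊕ Fin K → ℝ)) × (Fin d ⊕ Fin K → ℝ)) × ℝ =>
          B.armMean p.1.1.2 t (I (p.1.1.1, p.1.2)) :=
        measurable_armMean_select (by fun_prop) (hIm.comp (by fun_prop)) t
      unfold gaussianPDF gaussianPDFReal
      fun_prop
    have hfφ : Measurable fun p : ((History K t × (Fin d ⊕ Fin K → ℝ)) × (Fin d ⊕ Fin K → ℝ)) × ℝ =>
        f (φ (p.1.1.1, p.1.2, p.2), p.1.1.2) :=
      hf.comp ((hφm.comp (by fun_prop)).prodMk (by fun_prop))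
    have hGm : Measurable G :=
      Measurable.lintegral_prod_right' (f := fun q : (History K t × (Fin d ⊕ Fin K → ℝ)) ×
        (Fin d ⊕ Fin K → ℝ) => ∫⁻ y, gaussianPDF (B.armMean q.1.2 t (I (q.1.1, q.2)))
          (B.σ ^ 2).toNNReal y * f (φ (q.1.1, q.2, y), q.1.2))
        (Measurable.lintegral_prod_right' (hpdf.mul hfφ))
    have hnext : ∀ ω, B.history A sel (fun s => Z s ω) (t + 1)
        = φ (B.history A sel (fun s => Z s ω) t, (internalNoise t fun s => Z s ω),
          B.armMean (params fun s => Z s ω) t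
            (I (B.history A sel (fun s => Z s ω) t, internalNoise t fun s => Z s ω))
          + Z (.noise t (I (B.history A sel (fun s => Z s ω) t,
              internalNoise t fun s => Z s ω))) ω) := fun ω => by
      rw [hφ]; exact history_succ hA _ _
    -- average over the fresh randomness of round `t`
    have hfresh : ∫⁻ ω, f (B.history A sel (fun s => Z s ω) (t + 1), params fun s => Z s ω) ∂P
        = ∫⁻ ω, G (B.history A sel (fun s => Z s ω) t, params fun s => Z s ω) ∂P := by
      set ν := Measure.pi fun _ : Fin K => gaussianReal 0 (B.σ ^ 2).toNNReal with hν
      set g : (History K t × (Fin d ⊕ Fin K → ℝ)) × (Fin d ⊕ Fin K → ℝ) × (Fin K → ℝ) → ℝ≥0∞ :=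
        fun q => f (φ (q.1.1, q.2.1, B.armMean q.1.2 t (I (q.1.1, q.2.1))
          + q.2.2 (I (q.1.1, q.2.1))), q.1.2) with hg
      have hIq : Measurable fun q : (History K t × (Fin d ⊕ Fin K → ℝ)) ×
          (Fin d ⊕ Fin K → ℝ) × (Fin K → ℝ) => I (q.1.1, q.2.1) := hIm.comp (by fun_prop)
      have hgm : Measurable g := by
        refine hf.comp ((hφm.comp (Measurable.prodMk (by fun_prop) (Measurable.prodMk (by fun_prop)
          (Measurable.add ?_ ?_)))).prodMk (by fun_prop))
        · exact measurable_armMean_select (by fun_prop) hIq t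
        · exact measurable_select (f := fun i (q : (History K t × (Fin d ⊕ Fin K → ℝ)) ×
            (Fin d ⊕ Fin K → ℝ) × (Fin K → ℝ)) => q.2.2 i) (fun i => by fun_prop) hIq
      have hpast : Measurable fun ω =>
          (B.history A sel (fun s => Z s ω) t, params fun s => Z s ω) :=
        (measurable_history hA hsel fun s _ => hZ.measurable s).prodMk hβ
      have hnow : Measurable fun ω =>
          ((internalNoise t fun s => Z s ω), fun i => Z (.noise t i) ω) :=
        (measurable_internalNoise fun s _ => hZ.measurable s).prodMk
          (measurable_noise fun s _ => hZ.measurable s)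
      calc _ = ∫⁻ ω, g ((B.history A sel (fun s => Z s ω) t, params fun s => Z s ω),
            (internalNoise t fun s => Z s ω), fun i => Z (.noise t i) ω) ∂P := by
            simp only [hnext, hg]
        _ = ∫⁻ p, ∫⁻ q, g (p, q) ∂(γ.prod ν)
              ∂(P.map fun ω => (B.history A sel (fun s => Z s ω) t, params fun s => Z s ω)) := by
            rw [← lintegral_prod _ hgm.aemeasurable, ← map_history_params_noise hA hsel hZ t,
              lintegral_map hgm (hpast.prodMk hnow)]
        _ = ∫⁻ p, G p
              ∂(P.map fun ω => (B.history A sel (fun s => Z s ω) t, params fun s => Z s ω)) := by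
            refine lintegral_congr fun p => ?_
            rw [lintegral_prod (fun q => g (p, q)) (hgm.comp measurable_prodMk_left).aemeasurable]
            refine lintegral_congr fun ζ => ?_
            have h1 : Measurable fun y : ℝ => f (φ (p.1, ζ, y), p.2) :=
              hf.comp ((hφm.comp (by fun_prop)).prodMk (by fun_prop))
            have h2 := (measurePreserving_eval (fun _ : Fin K => gaussianReal 0 (B.σ ^ 2).toNNReal)
              (I (p.1, ζ))).lintegral_comp
              (f := fun e => f (φ (p.1, ζ, B.armMean p.2 t (I (p.1, ζ)) + e), p.2))
              (h1.comp (by fun_prop))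
            have h3 := lintegral_map (μ := gaussianReal 0 (B.σ ^ 2).toNNReal) h1
              (measurable_const_add (B.armMean p.2 t (I (p.1, ζ))))
            rw [gaussianReal_map_const_add, zero_add, gaussianReal_of_var_ne_zero _ hv,
              lintegral_withDensity_eq_lintegral_mul _ (measurable_gaussianPDF _ _) h1] at h3
            exact h2.trans h3.symm
        _ = _ := lintegral_map hGm hpast
    rw [hfresh, ih G hGm]
    have hL := measurable_likelihood_prod (t := t + 1) B
    have hK : Measurable fun h' => ∫⁻ β, B.likelihood h' β * f (h', β) ∂B.prior :=
      (hL.mul hf).lintegral_prod_right'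
    rw [lintegral_map hK hφm, lintegral_prod
      (fun p => ∫⁻ β, B.likelihood (φ p) β * f (φ p, β) ∂B.prior) (hK.comp hφm).aemeasurable]
    refine lintegral_congr fun h => ?_
    have hF : Measurable (Function.uncurry fun (q : (Fin d ⊕ Fin K → ℝ) × ℝ) β =>
        B.likelihood (φ (h, q)) β * f (φ (h, q), β)) :=
      (hL.mul hf).comp (f := fun p : ((Fin d ⊕ Fin K → ℝ) × ℝ) × (Fin d ⊕ Fin K → ℝ) =>
        (φ (h, p.1), p.2)) ((hφm.comp (by fun_prop)).prodMk (by fun_prop))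
    rw [lintegral_lintegral_swap hF.aemeasurable]
    refine lintegral_congr fun β => ?_
    rw [lintegral_prod (fun q => B.likelihood (φ (h, q)) β * f (φ (h, q), β))
        (hF.comp (g := Function.uncurry fun (q : (Fin d ⊕ Fin K → ℝ) × ℝ) β =>
          B.likelihood (φ (h, q)) β * f (φ (h, q), β))
          (f := fun q : (Fin d ⊕ Fin K → ℝ) × ℝ => (q, β)) (by fun_prop)).aemeasurable]
    have hW : Measurable fun x : (Fin d ⊕ Fin K → ℝ) × ℝ =>
        gaussianPDF (B.armMean β t (I (h, x.1))) (B.σ ^ 2).toNNReal x.2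
          * f (φ (h, x.1, x.2), β) :=
      (hpdf.mul hfφ).comp (f := fun x : (Fin d ⊕ Fin K → ℝ) × ℝ => (((h, β), x.1), x.2))
        (by fun_prop)
    have hin : ∀ ζ, ∫⁻ y, B.likelihood (φ (h, ζ, y)) β * f (φ (h, ζ, y), β)
        = B.likelihood h β * ∫⁻ y, gaussianPDF (B.armMean β t (I (h, ζ))) (B.σ ^ 2).toNNReal y
          * f (φ (h, ζ, y), β) := fun ζ => by
      refine Eq.trans (lintegral_congr fun y => ?_)
        (lintegral_const_mul _ (hW.comp (f := fun y : ℝ => (ζ, y)) (by fun_prop)))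
      simp only [hφ, likelihood_snoc, mul_assoc]
    simp only [hin, hG]
    rw [lintegral_const_mul _ hW.lintegral_prod_right']


/-- **Bayes' rule.** Given the history, the parameters are distributed as a posterior sample. -/
lemma map_history_params (hlam : 0 < B.lam) (hσ : 0 < B.σ) (hσ0 : 0 ≤ B.σ0)
    (hA : IsRoundwise A a) (hsel : IsArgmaxRule sel) (hZ : B.IsRealization P Z) (t : ℕ) :
    P.map (fun ω => (B.history A sel (fun s => Z s ω) t, params fun s => Z s ω))
      = ((P.map fun ω => B.history A sel (fun s => Z s ω) t).prod
          (stdGaussianPi (Fin d ⊕ Fin K))).map fun p => (p.1, B.posteriorSample p.1 p.2) := by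
  have hH : Measurable fun ω => B.history A sel (fun s => Z s ω) t :=
    measurable_history hA hsel fun s _ => hZ.measurable s
  have hβ : Measurable fun ω => params fun s => Z s ω :=
    measurable_params (t := 0) fun s _ => hZ.measurable s
  have hpost : Measurable fun p : History K t × (Fin d ⊕ Fin K → ℝ) =>
      (p.1, B.posteriorSample p.1 p.2) := measurable_fst.prodMk (measurable_posteriorSample B)
  obtain ⟨ρ, _, hlaw⟩ := exists_history_law hσ hA hsel hZ t
  refine Measure.ext_of_lintegral _ fun f hf => ?_
  have hg : Measurable fun h : History K t =>
      ∫⁻ w, f (h, B.posteriorSample h w) ∂stdGaussianPi (Fin d ⊕ Fin K) :=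
    Measurable.lintegral_prod_right' (f := fun p : History K t × (Fin d ⊕ Fin K → ℝ) =>
      f (p.1, B.posteriorSample p.1 p.2)) (hf.comp hpost)
  rw [lintegral_map hf (hH.prodMk hβ), lintegral_map hf hpost,
    lintegral_prod (fun p => f (p.1, B.posteriorSample p.1 p.2)) (hf.comp hpost).aemeasurable,
    lintegral_map hg hH, hlaw f hf,
    hlaw (fun p => ∫⁻ w, f (p.1, B.posteriorSample p.1 w) ∂stdGaussianPi (Fin d ⊕ Fin K))
      (hg.comp measurable_fst)]
  refine lintegral_congr fun h => ?_
  obtain ⟨C, hC⟩ := exists_lintegral_likelihood_eq h hlam hσ hσ0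
  rw [hC (fun β => f (h, β)) (hf.comp measurable_prodMk_left),
    hC (fun _ => ∫⁻ w, f (h, B.posteriorSample h w) ∂stdGaussianPi (Fin d ⊕ Fin K))
      measurable_const]
  simp

lemma map_history_params_internalNoise (hA : IsRoundwise A a) (hsel : IsArgmaxRule sel)
    (hZ : B.IsRealization P Z) (t : ℕ) :
    P.map (fun ω => ((B.history A sel (fun s => Z s ω) t, params fun s => Z s ω),
        internalNoise t fun s => Z s ω))
      = (P.map fun ω => (B.history A sel (fun s => Z s ω) t, params fun s => Z s ω)).prod
          (stdGaussianPi (Fin d ⊕ Fin K)) := by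
  have hpast : Measurable fun ω =>
      (B.history A sel (fun s => Z s ω) t, params fun s => Z s ω) :=
    (measurable_history hA hsel fun s _ => hZ.measurable s).prodMk
      (measurable_params (t := 0) fun s _ => hZ.measurable s)
  have hnow : Measurable fun ω =>
      ((internalNoise t fun s => Z s ω), fun i => Z (.noise t i) ω) :=
    (measurable_internalNoise fun s _ => hZ.measurable s).prodMk
      (measurable_noise fun s _ => hZ.measurable s)
  have := Measure.isProbabilityMeasure_map (μ := P) hpast.aemeasurable
  have h1 := congrArg (Measure.map (Prod.map id Prod.fst))
    (map_history_params_noise hA hsel hZ t)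
  rw [Measure.map_map (by fun_prop) (hpast.prodMk hnow),
    ← Measure.map_prod_map _ _ measurable_id measurable_fst, Measure.map_id] at h1
  refine h1.trans ?_
  congr 1
  exact measurePreserving_fst.map_eq

/-- A posterior sample has, jointly with the history, the law of the parameters. -/
lemma map_history_posteriorSample (hlam : 0 < B.lam) (hσ : 0 < B.σ) (hσ0 : 0 ≤ B.σ0)
    (hA : IsRoundwise A a) (hsel : IsArgmaxRule sel) (hZ : B.IsRealization P Z) (t : ℕ) :
    P.map (fun ω => (B.history A sel (fun s => Z s ω) t,
        B.posteriorSample (B.history A sel (fun s => Z s ω) t)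
          (internalNoise t fun s => Z s ω)))
      = P.map (fun ω => (B.history A sel (fun s => Z s ω) t, params fun s => Z s ω)) := by
  have hH : Measurable fun ω => B.history A sel (fun s => Z s ω) t :=
    measurable_history hA hsel fun s _ => hZ.measurable s
  have hβ : Measurable fun ω => params fun s => Z s ω :=
    measurable_params (t := 0) fun s _ => hZ.measurable s
  have hζ : Measurable fun ω => internalNoise t fun s => Z s ω :=
    measurable_internalNoise fun s _ => hZ.measurable s
  have hpost : Measurable fun p : History K t × (Fin d ⊕ Fin K → ℝ) =>
      (p.1, B.posteriorSample p.1 p.2) := measurable_fst.prodMk (measurable_posteriorSample B)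
  have := Measure.isProbabilityMeasure_map (μ := P) (hH.prodMk hβ).aemeasurable
  have h1 := congrArg (Measure.map (Prod.map Prod.fst id))
    (map_history_params_internalNoise hA hsel hZ t)
  rw [Measure.map_map (by fun_prop) ((hH.prodMk hβ).prodMk hζ),
    ← Measure.map_prod_map _ _ measurable_fst measurable_id, Measure.map_id,
    Measure.map_map measurable_fst (hH.prodMk hβ)] at h1
  rw [map_history_params hlam hσ hσ0 hA hsel hZ t]
  have h2 := congrArg (Measure.map fun p : History K t × (Fin d ⊕ Fin K → ℝ) =>
      (p.1, B.posteriorSample p.1 p.2)) h1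
  rw [Measure.map_map hpost ((measurable_fst.prodMap measurable_id).comp
    ((hH.prodMk hβ).prodMk hζ))] at h2
  exact h2

end PosteriorLaw

/-! ### Gaussian moments -/

section Moments

lemma map_dotProduct_stdGaussianPi {ι : Type*} [Fintype ι] (c : ι → ℝ) :
    (stdGaussianPi ι).map (fun ω => c ⬝ᵥ ω) = gaussianReal 0 (c ⬝ᵥ c).toNNReal := by
  classical
  set L : StrongDual ℝ (EuclideanSpace ℝ ι) := innerSL ℝ (WithLp.toLp 2 c) with hL
  have h1 : (fun ω : ι → ℝ => c ⬝ᵥ ω) = L ∘ WithLp.toLp 2 := by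
    funext ω
    simp [hL, EuclideanSpace.inner_eq_star_dotProduct, dotProduct_comm]
  have h2 : ‖L‖ ^ 2 = c ⬝ᵥ c := by
    rw [hL, innerSL_apply_norm, EuclideanSpace.real_norm_sq_eq]
    simp [dotProduct, sq]
  rw [h1, ← Measure.map_map L.continuous.measurable (by fun_prop), stdGaussianPi,
    map_pi_eq_stdGaussian, IsGaussian.map_eq_gaussianReal, integral_strongDual_stdGaussian,
    variance_dual_stdGaussian, h2]

lemma integrable_id_gaussianReal (v : ℝ≥0) : Integrable (fun x => x) (gaussianReal 0 v) :=
  (memLp_id_gaussianReal (μ := 0) (v := v) 1).integrable le_rfl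

lemma integral_abs_gaussianReal_le (v : ℝ≥0) : ∫ x, |x| ∂gaussianReal 0 v ≤ √v := by
  rcases eq_or_ne v 0 with rfl | hv
  · simp
  have hv' : 0 < √(v : ℝ) := Real.sqrt_pos.2 (by positivity)
  have h2 : ∫ x, x ^ 2 ∂gaussianReal 0 v = v := by
    have := variance_of_integral_eq_zero (μ := gaussianReal 0 v) (X := fun x => x)
      (by fun_prop) (by simp)
    rw [← this, variance_fun_id_gaussianReal]
  have hi2 : Integrable (fun x => x ^ 2) (gaussianReal 0 v) :=
    (memLp_id_gaussianReal (μ := 0) (v := v) 2).integrable_sq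
  calc ∫ x, |x| ∂gaussianReal 0 v
      ≤ ∫ x, (x ^ 2 / √v + √v) / 2 ∂gaussianReal 0 v := by
        refine integral_mono (integrable_id_gaussianReal v).abs
          (((hi2.div_const _).add (integrable_const _)).div_const _) fun x => ?_
        change |x| ≤ (x ^ 2 / √v + √v) / 2
        rw [le_div_iff₀ two_pos, ← sq_abs x, div_add' _ _ _ hv'.ne', le_div_iff₀ hv']
        nlinarith [sq_nonneg (|x| - √v)]
    _ = √v := by
        rw [integral_div, integral_add (hi2.div_const _) (integrable_const _), integral_div, h2]
        simp only [integral_const, probReal_univ, smul_eq_mul, one_mul, Real.div_sqrt]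
        ring

/-- The expected excess of a centered Gaussian over its upper confidence bound. -/
lemma integral_excess_gaussianReal_le (v : ℝ≥0) {n : ℕ} (hn : 1 ≤ n) :
    ∫ x, max (x - √(2 * v * Real.log n)) 0 ∂gaussianReal 0 v ≤ √v / (2 * n) := by
  rcases hn.eq_or_lt with rfl | hn
  · have h1 : ∀ x : ℝ, max (x - √(2 * v * Real.log (1 : ℕ))) 0 = (|x| + x) / 2 := fun x => by
      simp only [Nat.cast_one, Real.log_one, mul_zero, Real.sqrt_zero, sub_zero]
      rcases le_total 0 x with hx | hx
      · rw [max_eq_left hx, abs_of_nonneg hx]; ring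
      · rw [max_eq_right hx, abs_of_nonpos hx]; ring
    simp only [h1]
    rw [integral_div, integral_add (integrable_id_gaussianReal v).abs (integrable_id_gaussianReal v),
      integral_id_gaussianReal]
    have := integral_abs_gaussianReal_le v
    simp only [Nat.cast_one, mul_one, add_zero]
    linarith
  rcases eq_or_ne v 0 with rfl | hv
  · simp
  have hv0 : (0 : ℝ) < v := by positivity
  have hn0 : (0 : ℝ) < n := by positivity
  have hlog : (1 : ℝ) / 2 ≤ Real.log n := by
    have h2 : Real.log 2 ≤ Real.log n := Real.log_le_log two_pos (by exact_mod_cast hn)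
    linarith [Real.log_two_gt_d9]
  obtain ⟨s, hs⟩ : ∃ s, s = √(2 * v * Real.log n) := ⟨_, rfl⟩
  have hs2 : s ^ 2 = 2 * v * Real.log n := by rw [hs, Real.sq_sqrt (by positivity)]
  have hs0 : 0 < s := by rw [hs]; exact Real.sqrt_pos.2 (by positivity)
  rw [← hs]
  -- Chernoff bound with the exponent `k = s / v`
  set k := s / v with hk
  have hk0 : 0 < k := by positivity
  have hexp : ∀ x : ℝ, Real.exp (k * (x - s) - 1) / k
      = Real.exp (k * x) * (Real.exp (-(k * s) - 1) / k) := fun x => by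
    rw [← mul_div_assoc, ← Real.exp_add]
    congr 2
    ring
  have hint : Integrable (fun x => Real.exp (k * x)) (gaussianReal 0 v) :=
    integrable_exp_mul_gaussianReal k
  have hmgf : ∫ x, Real.exp (k * x) ∂gaussianReal 0 v = Real.exp (v * k ^ 2 / 2) := by
    have := congrFun (mgf_fun_id_gaussianReal (μ := 0) (v := v)) k
    simpa [mgf] using this
  calc ∫ x, max (x - s) 0 ∂gaussianReal 0 v
      ≤ ∫ x, Real.exp (k * x) * (Real.exp (-(k * s) - 1) / k) ∂gaussianReal 0 v := by
        refine integral_mono_of_nonneg (ae_of_all _ fun x => le_max_right _ _)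
          (hint.mul_const _) (ae_of_all _ fun x => ?_)
        change max (x - s) 0 ≤ Real.exp (k * x) * (Real.exp (-(k * s) - 1) / k)
        rw [← hexp]
        refine max_le ?_ (by positivity)
        rw [le_div_iff₀ hk0]
        linarith [Real.add_one_le_exp (k * (x - s) - 1)]
    _ = Real.exp (v * k ^ 2 / 2) * (Real.exp (-(k * s) - 1) / k) := by
        rw [integral_mul_const, hmgf]
    _ = Real.exp (-1) * (v / s) / n := by
        have h1 : v * k ^ 2 / 2 = Real.log n := by
          rw [hk, div_pow, hs2]; field_simp
        have h2 : k * s = 2 * Real.log n := by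
          rw [hk, div_mul_eq_mul_div, ← sq, hs2]; field_simp
        have h3 : Real.exp (-(2 * Real.log n) - 1) = Real.exp (-1) * ((n : ℝ)⁻¹ * (n : ℝ)⁻¹) := by
          rw [show -(2 * Real.log n) - 1 = -1 + (-Real.log n + -Real.log n) by ring,
            Real.exp_add, Real.exp_add, Real.exp_neg, Real.exp_neg (Real.log n), Real.exp_log hn0]
        rw [h1, h2, h3, Real.exp_log hn0, hk]
        field_simp
    _ ≤ 1 / 2 * √v / n := by
        have h1 : Real.exp (-1) ≤ 1 / 2 := by
          rw [Real.exp_neg, inv_le_comm₀ (Real.exp_pos _) (by norm_num)]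
          linarith [Real.add_one_le_exp 1]
        have h2 : v / s ≤ √v := by
          rw [div_le_iff₀ hs0, hs, ← Real.sqrt_mul hv0.le]
          refine Real.le_sqrt_of_sq_le ?_
          nlinarith
        gcongr
    _ = √v / (2 * n) := by ring

end Moments

/-! ### Posterior law of the mean rewards -/

section Round

variable {d K : ℕ} {B : Model d K}

open scoped MatrixOrder in
/-- In terms of the noise, the posterior sample of a mean reward is exactly the index of
`RoLinTS`. -/
lemma armMean_posteriorSample {t : ℕ} (h : History K t) (w : Fin d ⊕ Fin K → ℝ) (i : Fin K) :
    B.armMean (B.posteriorSample h w) t i = B.muHat h i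
      + B.calibContext h i ⬝ᵥ (CFC.sqrt (B.precision h)⁻¹ *ᵥ fun j => w (.inl j))
      + √(B.σ0 ^ 2 * (1 - B.weight h i)) * w (.inr i) := by
  have h1 : (fun j => B.posteriorSample h w (.inl j)) = B.thetaSample h w := rfl
  simp only [Model.armMean, h1]
  simp only [Model.posteriorSample, Sum.elim_inr, Model.muHat, Model.calibContext,
    Model.thetaSample, sub_dotProduct, smul_dotProduct, dotProduct_add, smul_eq_mul]
  ring

lemma roLinTS_eq {t : ℕ} (h : History K t) (z : Source d K → ℝ) :
    B.roLinTS t h z = fun i => B.armMean (B.posteriorSample h (internalNoise t z)) t i := by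
  funext i
  rw [armMean_posteriorSample]
  rfl

open scoped MatrixOrder in
/-- Given the history, the mean reward of arm `i` is Gaussian with mean `μ̂` and variance `τ²`. -/
lemma map_posteriorSample_sub (hlam : 0 < B.lam) (hσ : 0 < B.σ) {t : ℕ} (h : History K t)
    (i : Fin K) :
    (stdGaussianPi (Fin d ⊕ Fin K)).map
        (fun w => B.armMean (B.posteriorSample h w) t i - B.muHat h i)
      = gaussianReal 0 (B.tauSq h i).toNNReal := by
  set R := CFC.sqrt (B.precision h)⁻¹ with hR
  set c : Fin d ⊕ Fin K → ℝ :=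
    Sum.elim (R *ᵥ B.calibContext h i) (Pi.single i √(B.σ0 ^ 2 * (1 - B.weight h i))) with hc
  have hRt : Rᵀ = R := transpose_sqrt_inv_precision h
  have h1 : (fun w => B.armMean (B.posteriorSample h w) t i - B.muHat h i)
      = fun w => c ⬝ᵥ w := by
    funext w
    have hw : w = Sum.elim (fun j => w (.inl j)) (fun i => w (.inr i)) := by
      ext (j | i) <;> rfl
    rw [armMean_posteriorSample, hc]
    conv_rhs => rw [hw]
    rw [sumElim_dotProduct_sumElim, single_dotProduct, dotProduct_mulVec, ← mulVec_transpose,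
      ← hR, hRt]
    ring
  have h2 : c ⬝ᵥ c = B.tauSq h i := by
    have h0 : 0 ≤ B.σ0 ^ 2 * (1 - B.weight h i) :=
      mul_nonneg (sq_nonneg _) (one_sub_weight_pos h hσ i).le
    rw [hc, sumElim_dotProduct_sumElim, single_dotProduct, Pi.single_eq_same,
      Real.mul_self_sqrt h0, dotProduct_mulVec, ← mulVec_transpose, hRt, mulVec_mulVec, hR,
      sqrt_inv_precision_mul_self h hlam hσ, dotProduct_comm, Model.tauSq, add_comm]
  rw [h1, map_dotProduct_stdGaussianPi, h2]

end Round

/-! ### Confidence widths and the regret of a round -/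

section Regret

variable {d K : ℕ} {Ω : Type*} [MeasurableSpace Ω] {P : Measure Ω}
  {B : Model d K} {A : Agent d K} {sel : ℕ → (Fin K → ℝ) → Fin K}
  {a : (t : ℕ) → History K t → (Fin d ⊕ Fin K → ℝ) → Fin K → ℝ} {Z : Source d K → Ω → ℝ}

/-- The confidence width `√(2 τ² log n)` of arm `i`. -/
noncomputable def Model.width (B : Model d K) (n : ℕ) {t : ℕ} (h : History K t) (i : Fin K) : ℝ :=
  √(2 * B.tauSq h i * Real.log n)

/-- The deviation `μ - μ̂` of the mean reward of arm `i` in round `t` from its estimate. -/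
noncomputable def Model.deviation (B : Model d K) {t : ℕ} (i : Fin K)
    (p : History K t × (Fin d ⊕ Fin K → ℝ)) : ℝ :=
  B.armMean p.2 t i - B.muHat p.1 i

lemma measurable_width (n t : ℕ) (i : Fin K) :
    Measurable fun h : History K t => B.width n h i := by
  have := measurable_tauSq (t := t) B i
  unfold Model.width
  fun_prop

lemma measurable_deviation (t : ℕ) (i : Fin K) :
    Measurable fun p : History K t × (Fin d ⊕ Fin K → ℝ) => B.deviation i p :=
  ((measurable_armMean B t i).comp measurable_snd).sub
    ((measurable_muHat B i).comp measurable_fst)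

lemma width_nonneg (n : ℕ) {t : ℕ} (h : History K t) (i : Fin K) : 0 ≤ B.width n h i :=
  Real.sqrt_nonneg _

lemma width_le (hlam : 0 < B.lam) (hσ : 0 < B.σ) {L : ℝ} {n t : ℕ}
    (hx : ∀ i, ‖B.x t i‖ ≤ L) (h : History K t) (i : Fin K) :
    B.width n h i ≤ √(2 * B.sigmaMax L ^ 2 * Real.log n) := by
  have h1 := tauSq_le_sigmaMax_sq hlam hσ h (hx i)
  have h2 := Real.log_natCast_nonneg n
  unfold Model.width
  gcongr

lemma sqrt_tauSq_le (hlam : 0 < B.lam) (hσ : 0 < B.σ) {L : ℝ} {t : ℕ}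
    (hx : ∀ i, ‖B.x t i‖ ≤ L) (h : History K t) (i : Fin K) :
    √((B.tauSq h i).toNNReal : ℝ) ≤ B.sigmaMax L := by
  rw [Real.coe_toNNReal _ (tauSq_nonneg hlam hσ h i)]
  exact Real.sqrt_le_iff.2 ⟨Real.sqrt_nonneg _, tauSq_le_sigmaMax_sq hlam hσ h (hx i)⟩

lemma abs_select_le (f : Fin K → ℝ) (j : Fin K) : |f j| ≤ ∑ i, |f i| :=
  Finset.single_le_sum (f := fun i => |f i|) (fun _ _ => abs_nonneg _) (Finset.mem_univ j)

lemma integrable_select {f : Fin K → Ω → ℝ} (hf : ∀ i, Integrable (f i) P)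
    (hfm : ∀ i, Measurable (f i)) {J : Ω → Fin K} (hJ : Measurable J) :
    Integrable (fun ω => f (J ω) ω) P :=
  (integrable_finsetSum Finset.univ fun i _ => (hf i).abs).mono'
    (measurable_select hfm hJ).aestronglyMeasurable
    (ae_of_all _ fun ω => abs_select_le (fun i => f i ω) (J ω))

lemma measurable_past (hA : IsRoundwise A a) (hsel : IsArgmaxRule sel)
    (hZ : B.IsRealization P Z) (t : ℕ) :
    Measurable fun ω => (B.history A sel (fun s => Z s ω) t, params fun s => Z s ω) :=
  (measurable_history hA hsel fun s _ => hZ.measurable s).prodMk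
    (measurable_params (t := 0) fun s _ => hZ.measurable s)

lemma measurable_pulledArm (hA : IsRoundwise A a) (hsel : IsArgmaxRule sel)
    (hZ : B.IsRealization P Z) (t : ℕ) :
    Measurable fun ω => B.pulledArm A sel (fun s => Z s ω) t := by
  simp only [pulledArm_eq hA]
  exact (measurable_selected hA hsel t).comp
    ((measurable_history hA hsel fun s _ => hZ.measurable s).prodMk
      (measurable_internalNoise fun s _ => hZ.measurable s))

lemma integrable_armMean (hZ : B.IsRealization P Z) (t : ℕ) (i : Fin K) :
    Integrable (fun ω => B.armMean (params fun s => Z s ω) t i) P := by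
  have h1 : ∀ s, Integrable (Z s) P := fun s => by
    have h2 := integrable_id_gaussianReal (B.sourceVar s).toNNReal
    rw [← hZ.law s] at h2
    exact (integrable_map_measure (by fun_prop) (hZ.measurable s).aemeasurable).1 h2
  exact (integrable_finsetSum Finset.univ fun j _ => (h1 (.theta j)).const_mul _).add
    (h1 (.effect i))

section OneRound

variable [IsProbabilityMeasure P] {L : ℝ} {n t : ℕ}

lemma measurable_deviation_posteriorSample (t : ℕ) (i : Fin K) :
    Measurable fun p : History K t × (Fin d ⊕ Fin K → ℝ) =>
      B.deviation i (p.1, B.posteriorSample p.1 p.2) :=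
  (measurable_deviation t i).comp (f := fun p : History K t × (Fin d ⊕ Fin K → ℝ) =>
    (p.1, B.posteriorSample p.1 p.2)) (measurable_fst.prodMk (measurable_posteriorSample B))

lemma map_deviation_posteriorSample (hlam : 0 < B.lam) (hσ : 0 < B.σ) {t : ℕ} (h : History K t)
    (i : Fin K) :
    (stdGaussianPi (Fin d ⊕ Fin K)).map (fun w => B.deviation i (h, B.posteriorSample h w))
      = gaussianReal 0 (B.tauSq h i).toNNReal := by
  simpa only [Model.deviation] using map_posteriorSample_sub hlam hσ h i

/-- Expectations of functions of the deviation under the posterior are Gaussian integrals. -/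
lemma integral_comp_deviation_posteriorSample (hlam : 0 < B.lam) (hσ : 0 < B.σ) {t : ℕ}
    (h : History K t) (i : Fin K) {f : ℝ → ℝ} (hf : Measurable f) :
    ∫ w, f (B.deviation i (h, B.posteriorSample h w)) ∂stdGaussianPi (Fin d ⊕ Fin K)
      = ∫ x, f x ∂gaussianReal 0 (B.tauSq h i).toNNReal := by
  have hm : Measurable fun w => B.deviation i (h, B.posteriorSample h w) :=
    (measurable_deviation_posteriorSample t i).comp
      (f := fun w : Fin d ⊕ Fin K → ℝ => (h, w)) (by fun_prop)
  rw [← map_deviation_posteriorSample hlam hσ h i,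
    integral_map hm.aemeasurable hf.aestronglyMeasurable]

lemma integrable_deviation_posteriorSample (hlam : 0 < B.lam) (hσ : 0 < B.σ) {L : ℝ} {t : ℕ}
    (hx : ∀ i, ‖B.x t i‖ ≤ L) (μ : Measure (History K t)) [IsProbabilityMeasure μ] (i : Fin K) :
    Integrable (fun p => B.deviation i (p.1, B.posteriorSample p.1 p.2))
      (μ.prod (stdGaussianPi (Fin d ⊕ Fin K))) := by
  have hm := measurable_deviation_posteriorSample (B := B) t i
  have hmh : ∀ h : History K t, Measurable fun w => B.deviation i (h, B.posteriorSample h w) :=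
    fun h => hm.comp (f := fun w : Fin d ⊕ Fin K → ℝ => (h, w)) (by fun_prop)
  refine (integrable_prod_iff hm.aestronglyMeasurable).2 ⟨ae_of_all _ fun h => ?_, ?_⟩
  · have h1 := integrable_id_gaussianReal (B.tauSq h i).toNNReal
    rw [← map_deviation_posteriorSample hlam hσ h i] at h1
    exact (integrable_map_measure (by fun_prop) (hmh h).aemeasurable).1 h1
  · have hb : ∀ h : History K t, ∫ w, ‖B.deviation i (h, B.posteriorSample h w)‖
        ∂stdGaussianPi (Fin d ⊕ Fin K) ≤ B.sigmaMax L := fun h => by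
      rw [integral_comp_deviation_posteriorSample hlam hσ h i (f := fun x => ‖x‖) (by fun_prop)]
      exact (integral_abs_gaussianReal_le _).trans (sqrt_tauSq_le hlam hσ hx h i)
    refine Integrable.of_bound hm.stronglyMeasurable.norm.integral_prod_right'.aestronglyMeasurable
      (B.sigmaMax L) (ae_of_all _ fun h => ?_)
    rw [Real.norm_of_nonneg (integral_nonneg fun _ => norm_nonneg _)]
    exact hb h

/-- An expectation over the history and the parameters, computed with the posterior. -/
lemma integral_past_eq (hlam : 0 < B.lam) (hσ : 0 < B.σ) (hσ0 : 0 ≤ B.σ0)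
    (hA : IsRoundwise A a) (hsel : IsArgmaxRule sel) (hZ : B.IsRealization P Z)
    {g : History K t × (Fin d ⊕ Fin K → ℝ) → ℝ} (hg : Measurable g) :
    ∫ ω, g (B.history A sel (fun s => Z s ω) t, params fun s => Z s ω) ∂P
      = ∫ p, g (p.1, B.posteriorSample p.1 p.2)
        ∂((P.map fun ω => B.history A sel (fun s => Z s ω) t).prod
          (stdGaussianPi (Fin d ⊕ Fin K))) := by
  rw [← integral_map (φ := fun p : History K t × (Fin d ⊕ Fin K → ℝ) =>
      (p.1, B.posteriorSample p.1 p.2)) (measurable_fst.prodMk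
    (measurable_posteriorSample B)).aemeasurable hg.aestronglyMeasurable,
    ← map_history_params hlam hσ hσ0 hA hsel hZ t,
    integral_map (measurable_past hA hsel hZ t).aemeasurable hg.aestronglyMeasurable]

lemma integrable_deviation (hlam : 0 < B.lam) (hσ : 0 < B.σ) (hσ0 : 0 ≤ B.σ0)
    (hx : ∀ i, ‖B.x t i‖ ≤ L)
    (hA : IsRoundwise A a) (hsel : IsArgmaxRule sel) (hZ : B.IsRealization P Z) (i : Fin K) :
    Integrable (fun ω => B.deviation i
      (B.history A sel (fun s => Z s ω) t, params fun s => Z s ω)) P := by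
  have hH : Measurable fun ω => B.history A sel (fun s => Z s ω) t :=
    measurable_history hA hsel fun s _ => hZ.measurable s
  have := Measure.isProbabilityMeasure_map (μ := P) hH.aemeasurable
  have h1 := integrable_deviation_posteriorSample hlam hσ hx
    (P.map fun ω => B.history A sel (fun s => Z s ω) t) i
  have h2 := (integrable_map_measure (f := fun p : History K t × (Fin d ⊕ Fin K → ℝ) =>
      (p.1, B.posteriorSample p.1 p.2)) (measurable_deviation t i).aestronglyMeasurable
    (measurable_fst.prodMk (measurable_posteriorSample B)).aemeasurable).2 h1
  rw [← map_history_params hlam hσ hσ0 hA hsel hZ t] at h2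
  exact (integrable_map_measure (measurable_deviation t i).aestronglyMeasurable
    (measurable_past hA hsel hZ t).aemeasurable).1 h2

lemma integrable_excess (hlam : 0 < B.lam) (hσ : 0 < B.σ) (hσ0 : 0 ≤ B.σ0)
    (hx : ∀ i, ‖B.x t i‖ ≤ L)
    (hA : IsRoundwise A a) (hsel : IsArgmaxRule sel) (hZ : B.IsRealization P Z) (i : Fin K) :
    Integrable (fun ω => max (B.deviation i
      (B.history A sel (fun s => Z s ω) t, params fun s => Z s ω)
        - B.width n (B.history A sel (fun s => Z s ω) t) i) 0) P := by
  have hm : Measurable fun ω => max (B.deviation i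
      (B.history A sel (fun s => Z s ω) t, params fun s => Z s ω)
        - B.width n (B.history A sel (fun s => Z s ω) t) i) 0 :=
    (((measurable_deviation t i).comp (measurable_past hA hsel hZ t)).sub
      ((measurable_width n t i).comp (measurable_history hA hsel
        fun s _ => hZ.measurable s))).max measurable_const
  refine (integrable_deviation hlam hσ hσ0 hx hA hsel hZ i).abs.mono' hm.aestronglyMeasurable
    (ae_of_all _ fun ω => ?_)
  rw [Real.norm_of_nonneg (le_max_right _ _)]
  have h1 := width_nonneg (B := B) n (B.history A sel (fun s => Z s ω) t) i
  exact max_le ((sub_le_self _ h1).trans (le_abs_self _)) (abs_nonneg _)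

/-- The upper confidence bound of an arm is rarely exceeded. -/
lemma integral_excess_le (hlam : 0 < B.lam) (hσ : 0 < B.σ) (hσ0 : 0 ≤ B.σ0) (hn : 1 ≤ n)
    (hx : ∀ i, ‖B.x t i‖ ≤ L)
    (hA : IsRoundwise A a) (hsel : IsArgmaxRule sel) (hZ : B.IsRealization P Z) (i : Fin K) :
    ∫ ω, max (B.deviation i (B.history A sel (fun s => Z s ω) t, params fun s => Z s ω)
        - B.width n (B.history A sel (fun s => Z s ω) t) i) 0 ∂P ≤ B.sigmaMax L / (2 * n) := by
  have hH : Measurable fun ω => B.history A sel (fun s => Z s ω) t :=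
    measurable_history hA hsel fun s _ => hZ.measurable s
  have := Measure.isProbabilityMeasure_map (μ := P) hH.aemeasurable
  have hm : Measurable fun p : History K t × (Fin d ⊕ Fin K → ℝ) =>
      max (B.deviation i p - B.width n p.1 i) 0 :=
    ((measurable_deviation t i).sub ((measurable_width n t i).comp measurable_fst)).max
      measurable_const
  have hpost : Measurable fun p : History K t × (Fin d ⊕ Fin K → ℝ) =>
      (p.1, B.posteriorSample p.1 p.2) := measurable_fst.prodMk (measurable_posteriorSample B)
  have hint : Integrable (fun p : History K t × (Fin d ⊕ Fin K → ℝ) =>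
      max (B.deviation i (p.1, B.posteriorSample p.1 p.2) - B.width n p.1 i) 0)
      ((P.map fun ω => B.history A sel (fun s => Z s ω) t).prod
        (stdGaussianPi (Fin d ⊕ Fin K))) := by
    refine (integrable_deviation_posteriorSample hlam hσ hx _ i).abs.mono'
      (hm.comp hpost).aestronglyMeasurable (ae_of_all _ fun p => ?_)
    rw [Real.norm_of_nonneg (le_max_right _ _)]
    exact max_le ((sub_le_self _ (width_nonneg n p.1 i)).trans (le_abs_self _)) (abs_nonneg _)
  rw [integral_past_eq hlam hσ hσ0 hA hsel hZ hm, integral_prod _ hint]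
  refine (integral_mono hint.integral_prod_left (integrable_const (B.sigmaMax L / (2 * n)))
    fun h => ?_).trans (by simp)
  have h1 := integral_excess_gaussianReal_le (B.tauSq h i).toNNReal hn
  rw [← integral_comp_deviation_posteriorSample hlam hσ h i (by fun_prop),
    Real.coe_toNNReal _ (tauSq_nonneg hlam hσ h i)] at h1
  refine h1.trans ?_
  have h2 := sqrt_tauSq_le hlam hσ hx h i
  rw [Real.coe_toNNReal _ (tauSq_nonneg hlam hσ h i)] at h2
  gcongr

/-- The estimate of the pulled arm is unbiased: the arm is a function of the history and of noise
that is independent of the parameters. -/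
lemma integral_deviation_pulledArm (hlam : 0 < B.lam) (hσ : 0 < B.σ) (hσ0 : 0 ≤ B.σ0)
    (hx : ∀ i, ‖B.x t i‖ ≤ L)
    (hA : IsRoundwise A a) (hsel : IsArgmaxRule sel) (hZ : B.IsRealization P Z) :
    ∫ ω, B.deviation (B.pulledArm A sel (fun s => Z s ω) t)
      (B.history A sel (fun s => Z s ω) t, params fun s => Z s ω) ∂P = 0 := by
  have hH : Measurable fun ω => B.history A sel (fun s => Z s ω) t :=
    measurable_history hA hsel fun s _ => hZ.measurable s
  have hζ : Measurable fun ω => internalNoise t fun s => Z s ω :=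
    measurable_internalNoise fun s _ => hZ.measurable s
  have hpast := measurable_past hA hsel hZ t
  have := Measure.isProbabilityMeasure_map (μ := P) hH.aemeasurable
  have := Measure.isProbabilityMeasure_map (μ := P) hpast.aemeasurable
  have hI := measurable_selected hA hsel t
  set g : (History K t × (Fin d ⊕ Fin K → ℝ)) × (Fin d ⊕ Fin K → ℝ) → ℝ :=
    fun q => B.deviation (sel t (a t q.1.1 q.2)) q.1 with hg
  have hgm : Measurable g :=
    measurable_select (f := fun i (q : (History K t × (Fin d ⊕ Fin K → ℝ)) ×
      (Fin d ⊕ Fin K → ℝ)) => B.deviation i q.1)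
      (fun i => (measurable_deviation t i).comp measurable_fst)
      (hI.comp (f := fun q : (History K t × (Fin d ⊕ Fin K → ℝ)) ×
        (Fin d ⊕ Fin K → ℝ) => (q.1.1, q.2)) (by fun_prop))
  have hgP : Integrable (fun ω => g ((B.history A sel (fun s => Z s ω) t,
      params fun s => Z s ω), internalNoise t fun s => Z s ω)) P :=
    integrable_select (fun i => integrable_deviation hlam hσ hσ0 hx hA hsel hZ i)
      (fun i => (measurable_deviation t i).comp hpast) (hI.comp (hH.prodMk hζ))
  have hgi := (integrable_map_measure hgm.aestronglyMeasurable
    (hpast.prodMk hζ).aemeasurable).2 hgP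
  simp only [pulledArm_eq hA]
  change ∫ ω, g ((B.history A sel (fun s => Z s ω) t,
      params fun s => Z s ω), internalNoise t fun s => Z s ω) ∂P = 0
  rw [← integral_map (hpast.prodMk hζ).aemeasurable hgm.aestronglyMeasurable]
  rw [map_history_params_internalNoise hA hsel hZ t] at hgi ⊢
  rw [integral_prod_symm _ hgi]
  refine integral_eq_zero_of_ae (ae_of_all _ fun ζ => ?_)
  change ∫ p, g (p, ζ) ∂(P.map fun ω =>
    (B.history A sel (fun s => Z s ω) t, params fun s => Z s ω)) = 0
  have hgζ : Measurable fun p => g (p, ζ) := hgm.comp measurable_prodMk_right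
  rw [integral_map hpast.aemeasurable hgζ.aestronglyMeasurable,
    integral_past_eq hlam hσ hσ0 hA hsel hZ hgζ, integral_prod]
  · refine integral_eq_zero_of_ae (ae_of_all _ fun h => ?_)
    have h1 := integral_id_gaussianReal (μ := 0) (v := (B.tauSq h (sel t (a t h ζ))).toNNReal)
    rw [← integral_comp_deviation_posteriorSample hlam hσ h _ measurable_id'] at h1
    exact h1
  · refine integrable_select (fun i => integrable_deviation_posteriorSample hlam hσ hx _ i)
      (fun i => (measurable_deviation t i).comp
        (measurable_fst.prodMk (measurable_posteriorSample B)))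
      (hI.comp (f := fun p : History K t × (Fin d ⊕ Fin K → ℝ) => (p.1, ζ)) (by fun_prop))

/-- The upper confidence bound `μ̂ + √(2 τ² log n)`. -/
noncomputable def Model.upperBound (B : Model d K) (n : ℕ) {t : ℕ} (h : History K t)
    (i : Fin K) : ℝ :=
  B.muHat h i + B.width n h i

lemma measurable_upperBound (n t : ℕ) (i : Fin K) :
    Measurable fun h : History K t => B.upperBound n h i :=
  (measurable_muHat B i).add (measurable_width n t i)

lemma integrable_width (hlam : 0 < B.lam) (hσ : 0 < B.σ)
    (hx : ∀ i, ‖B.x t i‖ ≤ L)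
    (hA : IsRoundwise A a) (hsel : IsArgmaxRule sel) (hZ : B.IsRealization P Z) (i : Fin K) :
    Integrable (fun ω => B.width n (B.history A sel (fun s => Z s ω) t) i) P := by
  refine Integrable.of_bound ((measurable_width n t i).comp (measurable_history hA hsel
    fun s _ => hZ.measurable s)).aestronglyMeasurable
    (√(2 * B.sigmaMax L ^ 2 * Real.log n)) (ae_of_all _ fun ω => ?_)
  rw [Real.norm_of_nonneg (width_nonneg _ _ _)]
  exact width_le hlam hσ hx _ i

lemma integrable_upperBound (hlam : 0 < B.lam) (hσ : 0 < B.σ) (hσ0 : 0 ≤ B.σ0)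
    (hx : ∀ i, ‖B.x t i‖ ≤ L)
    (hA : IsRoundwise A a) (hsel : IsArgmaxRule sel) (hZ : B.IsRealization P Z) (i : Fin K) :
    Integrable (fun ω => B.upperBound n (B.history A sel (fun s => Z s ω) t) i) P := by
  refine (((integrable_armMean hZ t i).sub
    (integrable_deviation hlam hσ hσ0 hx hA hsel hZ i)).add
    (integrable_width (n := n) hlam hσ hx hA hsel hZ i)).congr (ae_of_all _ fun ω => ?_)
  simp [Model.upperBound, Model.deviation]

/-- The regret of one round, provided that the expected upper confidence bound of the pulled arm is
at least that of the optimal arm. -/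
lemma integral_regret_round_le (hlam : 0 < B.lam) (hσ : 0 < B.σ) (hσ0 : 0 ≤ B.σ0) (hn : 1 ≤ n)
    (hx : ∀ i, ‖B.x t i‖ ≤ L)
    (hA : IsRoundwise A a) (hsel : IsArgmaxRule sel) (hZ : B.IsRealization P Z)
    (hC : ∫ ω, B.upperBound n (B.history A sel (fun s => Z s ω) t)
          (sel t (B.armMean (params fun s => Z s ω) t)) ∂P
        ≤ ∫ ω, B.upperBound n (B.history A sel (fun s => Z s ω) t)
          (B.pulledArm A sel (fun s => Z s ω) t) ∂P) :
    ∫ ω, (B.armMean (params fun s => Z s ω) t (sel t (B.armMean (params fun s => Z s ω) t))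
        - B.armMean (params fun s => Z s ω) t (B.pulledArm A sel (fun s => Z s ω) t)) ∂P
      ≤ K * (B.sigmaMax L / (2 * n))
        + ∫ ω, B.width n (B.history A sel (fun s => Z s ω) t)
          (B.pulledArm A sel (fun s => Z s ω) t) ∂P := by
  have hH : Measurable fun ω => B.history A sel (fun s => Z s ω) t :=
    measurable_history hA hsel fun s _ => hZ.measurable s
  have hβ : Measurable fun ω => params fun s => Z s ω :=
    measurable_params (t := 0) fun s _ => hZ.measurable s
  have hpast := measurable_past hA hsel hZ t
  have hJ := measurable_pulledArm hA hsel hZ t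
  have hS : Measurable fun ω => sel t (B.armMean (params fun s => Z s ω) t) :=
    (hsel.measurable t).comp (measurable_pi_iff.2 fun i => (measurable_armMean B t i).comp hβ)
  have hCm : ∀ i, Measurable fun ω => B.upperBound n (B.history A sel (fun s => Z s ω) t) i :=
    fun i => (measurable_upperBound n t i).comp hH
  have hCi := fun i => integrable_upperBound (n := n) hlam hσ hσ0 hx hA hsel hZ i
  have iCS := integrable_select hCi hCm hS
  have iCJ := integrable_select hCi hCm hJ
  have iW := integrable_select (fun i => integrable_width (n := n) hlam hσ hx hA hsel hZ i)
    (fun i => (measurable_width n t i).comp hH) hJ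
  have iD := integrable_select (fun i => integrable_deviation hlam hσ hσ0 hx hA hsel hZ i)
    (fun i => (measurable_deviation t i).comp hpast) hJ
  have iE := fun i => integrable_excess (n := n) hlam hσ hσ0 hx hA hsel hZ i
  have iμ : ∀ {J : Ω → Fin K}, Measurable J →
      Integrable (fun ω => B.armMean (params fun s => Z s ω) t (J ω)) P := fun hJ =>
    integrable_select (integrable_armMean hZ t) (fun i => (measurable_armMean B t i).comp hβ) hJ
  have hD := integral_deviation_pulledArm hlam hσ hσ0 hx hA hsel hZ
  calc _ ≤ ∫ ω, ((∑ i, max (B.deviation i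
            (B.history A sel (fun s => Z s ω) t, params fun s => Z s ω)
              - B.width n (B.history A sel (fun s => Z s ω) t) i) 0)
          + (B.upperBound n (B.history A sel (fun s => Z s ω) t)
              (sel t (B.armMean (params fun s => Z s ω) t))
            - B.upperBound n (B.history A sel (fun s => Z s ω) t)
              (B.pulledArm A sel (fun s => Z s ω) t))
          + (B.width n (B.history A sel (fun s => Z s ω) t)
              (B.pulledArm A sel (fun s => Z s ω) t)
            - B.deviation (B.pulledArm A sel (fun s => Z s ω) t)
              (B.history A sel (fun s => Z s ω) t, params fun s => Z s ω))) ∂P := by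
        refine integral_mono ((iμ hS).sub (iμ hJ))
          (((integrable_finsetSum _ fun i _ => iE i).add (iCS.sub iCJ)).add (iW.sub iD))
          fun ω => ?_
        have h1 := Finset.single_le_sum (f := fun i => max (B.deviation i
            (B.history A sel (fun s => Z s ω) t, params fun s => Z s ω)
              - B.width n (B.history A sel (fun s => Z s ω) t) i) 0)
          (fun i _ => le_max_right _ _)
          (Finset.mem_univ (sel t (B.armMean (params fun s => Z s ω) t)))
        have h2 := (le_max_left _ _).trans h1
        simp only [Model.upperBound, Model.deviation] at h2 ⊢
        linarith
    _ = (∑ i, ∫ ω, max (B.deviation i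
            (B.history A sel (fun s => Z s ω) t, params fun s => Z s ω)
              - B.width n (B.history A sel (fun s => Z s ω) t) i) 0 ∂P)
          + ((∫ ω, B.upperBound n (B.history A sel (fun s => Z s ω) t)
              (sel t (B.armMean (params fun s => Z s ω) t)) ∂P)
            - ∫ ω, B.upperBound n (B.history A sel (fun s => Z s ω) t)
              (B.pulledArm A sel (fun s => Z s ω) t) ∂P)
          + ((∫ ω, B.width n (B.history A sel (fun s => Z s ω) t)
              (B.pulledArm A sel (fun s => Z s ω) t) ∂P) - 0) := by
        have iS := integrable_finsetSum Finset.univ fun i _ => iE i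
        refine (integral_add (iS.add (iCS.sub iCJ)) (iW.sub iD)).trans (congrArg₂ (· + ·)
          ((integral_add iS (iCS.sub iCJ)).trans (congrArg₂ (· + ·)
            (integral_finsetSum _ fun i _ => iE i) (integral_sub iCS iCJ)))
          ((integral_sub iW iD).trans ?_))
        rw [hD]
    _ ≤ _ := by
        have h1 := Finset.sum_le_card_nsmul Finset.univ _ _ fun i _ =>
          integral_excess_le hlam hσ hσ0 hn hx hA hsel hZ i
        rw [Finset.card_univ, Fintype.card_fin, nsmul_eq_mul] at h1
        linarith

end OneRound

lemma iSup_meanReward (hsel : IsArgmaxRule sel) (z : Source d K → ℝ) (t : ℕ) :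
    ⨆ i, B.meanReward z t i = B.armMean (params z) t (sel t (B.armMean (params z) t)) := by
  have : Nonempty (Fin K) := ⟨sel t 0⟩
  exact le_antisymm (ciSup_le fun i => hsel.le t _ i)
    (le_ciSup (f := fun i => B.meanReward z t i) (Set.finite_range _).bddAbove _)

/-- The Cauchy-Schwarz inequality and the elliptical potential bound the total width. -/
lemma sum_width_le (hlam : 0 < B.lam) (hσ : 0 < B.σ) {L : ℝ} {n : ℕ}
    (hx : ∀ t < n, ∀ i, ‖B.x t i‖ ≤ L) (z : Source d K → ℝ) :
    ∑ t ∈ Finset.range n, B.width n (B.history A sel z t) (B.pulledArm A sel z t)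
      ≤ B.sigmaMax L * √(2 * B.logConst L n * (d + K) * n * Real.log n) := by
  have hlog := Real.log_natCast_nonneg n
  have hτ := sum_tauSq_le hlam hσ hx (B.pulledArm A sel z) (B.history A sel z)
    (history_apply_fst A z)
  have hcs := sq_sum_le_card_mul_sum_sq (s := Finset.range n)
    (f := fun t => B.width n (B.history A sel z t) (B.pulledArm A sel z t))
  have hsq : ∑ t ∈ Finset.range n,
        B.width n (B.history A sel z t) (B.pulledArm A sel z t) ^ 2
      = (∑ t ∈ Finset.range n, B.tauSq (B.history A sel z t) (B.pulledArm A sel z t))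
        * (2 * Real.log n) := by
    rw [Finset.sum_mul]
    refine Finset.sum_congr rfl fun t _ => ?_
    have := tauSq_nonneg hlam hσ (B.history A sel z t) (B.pulledArm A sel z t)
    rw [Model.width, Real.sq_sqrt (by positivity)]
    ring
  have hm : 0 ≤ B.sigmaMax L := Real.sqrt_nonneg _
  calc _ ≤ √(B.sigmaMax L ^ 2 * (2 * B.logConst L n * (d + K) * n * Real.log n)) := by
        refine Real.le_sqrt_of_sq_le (hcs.trans ?_)
        rw [hsq, Finset.card_range]
        calc _ ≤ n * (B.sigmaMax L ^ 2 * (B.logConst L n * (d + K)) * (2 * Real.log n)) := by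
              gcongr
          _ = _ := by ring
    _ = _ := by rw [Real.sqrt_mul (sq_nonneg _), Real.sqrt_sq hm]

variable [IsProbabilityMeasure P]

/-- The regret bound for an agent for which, in each round, the expected upper confidence bound of
the pulled arm is at least that of the optimal arm. -/
lemma regret_le (hlam : 0 < B.lam) (hσ : 0 < B.σ) (hσ0 : 0 ≤ B.σ0) {L : ℝ} {n : ℕ}
    (hx : ∀ t < n, ∀ i, ‖B.x t i‖ ≤ L)
    (hA : IsRoundwise A a) (hsel : IsArgmaxRule sel) (hZ : B.IsRealization P Z)
    (hC : ∀ t < n, ∫ ω, B.upperBound n (B.history A sel (fun s => Z s ω) t)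
          (sel t (B.armMean (params fun s => Z s ω) t)) ∂P
        ≤ ∫ ω, B.upperBound n (B.history A sel (fun s => Z s ω) t)
          (B.pulledArm A sel (fun s => Z s ω) t) ∂P) :
    Integrable (fun ω => B.regret A sel (fun s => Z s ω) n) P ∧
      ∫ ω, B.regret A sel (fun s => Z s ω) n ∂P ≤ B.regretBound L n := by
  have hβ : Measurable fun ω => params fun s => Z s ω :=
    measurable_params (t := 0) fun s _ => hZ.measurable s
  have hS : ∀ t, Measurable fun ω => sel t (B.armMean (params fun s => Z s ω) t) := fun t =>
    (hsel.measurable t).comp (measurable_pi_iff.2 fun i => (measurable_armMean B t i).comp hβ)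
  have iμ : ∀ (t : ℕ) {J : Ω → Fin K}, Measurable J →
      Integrable (fun ω => B.armMean (params fun s => Z s ω) t (J ω)) P := fun t _ hJ =>
    integrable_select (integrable_armMean hZ t) (fun i => (measurable_armMean B t i).comp hβ) hJ
  have iR : ∀ t, Integrable (fun ω => B.armMean (params fun s => Z s ω) t
      (sel t (B.armMean (params fun s => Z s ω) t)) - B.armMean (params fun s => Z s ω) t
        (B.pulledArm A sel (fun s => Z s ω) t)) P :=
    fun t => (iμ t (hS t)).sub (iμ t (measurable_pulledArm hA hsel hZ t))
  have hm : 0 ≤ B.sigmaMax L := Real.sqrt_nonneg _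
  simp only [Model.regret, iSup_meanReward hsel]
  simp only [meanReward_eq_armMean]
  refine ⟨integrable_finsetSum _ fun t _ => iR t, ?_⟩
  rw [integral_finsetSum _ fun t _ => iR t]
  have iW : ∀ t ∈ Finset.range n, Integrable (fun ω =>
      B.width n (B.history A sel (fun s => Z s ω) t) (B.pulledArm A sel (fun s => Z s ω) t)) P :=
    fun t ht => integrable_select
      (fun i => integrable_width hlam hσ (hx t (Finset.mem_range.1 ht)) hA hsel hZ i)
      (fun i => (measurable_width n t i).comp
        (measurable_history hA hsel fun s _ => hZ.measurable s))
      (measurable_pulledArm hA hsel hZ t)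
  calc _ ≤ ∑ t ∈ Finset.range n, (K * (B.sigmaMax L / (2 * n))
        + ∫ ω, B.width n (B.history A sel (fun s => Z s ω) t)
          (B.pulledArm A sel (fun s => Z s ω) t) ∂P) :=
        Finset.sum_le_sum fun t ht => by
          have htn := Finset.mem_range.1 ht
          exact integral_regret_round_le hlam hσ hσ0 (by omega) (hx t htn) hA hsel hZ (hC t htn)
    _ = n * (K * (B.sigmaMax L / (2 * n))) + ∫ ω, ∑ t ∈ Finset.range n,
          B.width n (B.history A sel (fun s => Z s ω) t)
            (B.pulledArm A sel (fun s => Z s ω) t) ∂P := by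
        rw [Finset.sum_add_distrib, integral_finsetSum _ iW]
        simp
    _ ≤ √(2 / Real.pi) * B.sigmaMax L * K
          + B.sigmaMax L * √(2 * B.logConst L n * (d + K) * n * Real.log n) := by
        refine add_le_add ?_ ?_
        · have hpi : (1 : ℝ) / 2 ≤ √(2 / Real.pi) := by
            refine Real.le_sqrt_of_sq_le ?_
            rw [le_div_iff₀ Real.pi_pos]
            linarith [Real.pi_le_four]
          calc n * (K * (B.sigmaMax L / (2 * n))) = (n / n) * (1 / 2 * B.sigmaMax L * K) := by
                ring
            _ ≤ 1 * (√(2 / Real.pi) * B.sigmaMax L * K) := by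
                gcongr
                exact div_self_le_one _
            _ = _ := one_mul _
        · calc _ ≤ ∫ _, B.sigmaMax L * √(2 * B.logConst L n * (d + K) * n * Real.log n) ∂P :=
                integral_mono (integrable_finsetSum _ iW) (integrable_const _)
                  fun ω => sum_width_le hlam hσ hx _
            _ = _ := by simp
    _ = B.regretBound L n := by rw [Model.regretBound, add_comm]

/-! ### The two algorithms -/

lemma isRoundwise_roLinUCB (n : ℕ) :
    IsRoundwise (B.roLinUCB n) fun _ h _ => B.upperBound n h where
  eq _ _ _ := rfl
  measurable t := measurable_pi_iff.2 fun i =>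
    (measurable_upperBound n t i).comp measurable_fst

lemma isRoundwise_roLinTS :
    IsRoundwise B.roLinTS fun t h w => B.armMean (B.posteriorSample h w) t where
  eq _ h z := roLinTS_eq h z
  measurable t := measurable_pi_iff.2 fun i =>
    (measurable_armMean B t i).comp (measurable_posteriorSample B)

/-- `RoLinUCB` pulls the arm with the highest upper confidence bound. -/
lemma roLinUCB_regret_le (hlam : 0 < B.lam) (hσ : 0 < B.σ) (hσ0 : 0 ≤ B.σ0) {L : ℝ} {n : ℕ}
    (hx : ∀ t < n, ∀ i, ‖B.x t i‖ ≤ L) (hsel : IsArgmaxRule sel) (hZ : B.IsRealization P Z) :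
    Integrable (fun ω => B.regret (B.roLinUCB n) sel (fun s => Z s ω) n) P ∧
      ∫ ω, B.regret (B.roLinUCB n) sel (fun s => Z s ω) n ∂P ≤ B.regretBound L n := by
  have hA := isRoundwise_roLinUCB (B := B) n
  have hβ : Measurable fun ω => params fun s => Z s ω :=
    measurable_params (t := 0) fun s _ => hZ.measurable s
  refine regret_le hlam hσ hσ0 hx hA hsel hZ fun t ht => ?_
  have hCm : ∀ i, Measurable fun ω =>
      B.upperBound n (B.history (B.roLinUCB n) sel (fun s => Z s ω) t) i := fun i =>
    (measurable_upperBound n t i).comp (measurable_history hA hsel fun s _ => hZ.measurable s)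
  have hCi := fun i => integrable_upperBound (n := n) hlam hσ hσ0 (hx t ht) hA hsel hZ i
  refine integral_mono (integrable_select hCi hCm ((hsel.measurable t).comp
    (measurable_pi_iff.2 fun i => (measurable_armMean B t i).comp hβ)))
    (integrable_select hCi hCm (measurable_pulledArm hA hsel hZ t)) fun ω => ?_
  simp only [pulledArm_eq hA]
  exact hsel.le t _ _

/-- Given the history, the arm that `RoLinTS` pulls has the law of the optimal arm. -/
lemma roLinTS_regret_le (hlam : 0 < B.lam) (hσ : 0 < B.σ) (hσ0 : 0 ≤ B.σ0) {L : ℝ} {n : ℕ}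
    (hx : ∀ t < n, ∀ i, ‖B.x t i‖ ≤ L) (hsel : IsArgmaxRule sel) (hZ : B.IsRealization P Z) :
    Integrable (fun ω => B.regret B.roLinTS sel (fun s => Z s ω) n) P ∧
      ∫ ω, B.regret B.roLinTS sel (fun s => Z s ω) n ∂P ≤ B.regretBound L n := by
  have hA := isRoundwise_roLinTS (B := B)
  refine regret_le hlam hσ hσ0 hx hA hsel hZ fun t _ => le_of_eq ?_
  set F : History K t × (Fin d ⊕ Fin K → ℝ) → ℝ := fun p =>
    B.upperBound n p.1 (sel t (B.armMean p.2 t)) with hF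
  have hFm : Measurable F :=
    measurable_select (f := fun i (p : History K t × (Fin d ⊕ Fin K → ℝ)) => B.upperBound n p.1 i)
      (fun i => (measurable_upperBound n t i).comp measurable_fst)
      ((hsel.measurable t).comp (measurable_pi_iff.2 fun i =>
        (measurable_armMean B t i).comp measurable_snd))
  have hH : Measurable fun ω => B.history B.roLinTS sel (fun s => Z s ω) t :=
    measurable_history hA hsel fun s _ => hZ.measurable s
  have hζ : Measurable fun ω => internalNoise t fun s => Z s ω :=
    measurable_internalNoise fun s _ => hZ.measurable s
  have hsample : Measurable fun ω => (B.history B.roLinTS sel (fun s => Z s ω) t,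
      B.posteriorSample (B.history B.roLinTS sel (fun s => Z s ω) t)
        (internalNoise t fun s => Z s ω)) :=
    hH.prodMk ((measurable_posteriorSample B).comp (f := fun ω =>
      (B.history B.roLinTS sel (fun s => Z s ω) t, internalNoise t fun s => Z s ω))
      (hH.prodMk hζ))
  have h1 : ∫ ω, F (B.history B.roLinTS sel (fun s => Z s ω) t, params fun s => Z s ω) ∂P
      = ∫ ω, F (B.history B.roLinTS sel (fun s => Z s ω) t,
          B.posteriorSample (B.history B.roLinTS sel (fun s => Z s ω) t)
            (internalNoise t fun s => Z s ω)) ∂P := by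
    clear_value F
    rw [← integral_map (measurable_past hA hsel hZ t).aemeasurable hFm.aestronglyMeasurable,
      ← map_history_posteriorSample hlam hσ hσ0 hA hsel hZ t,
      integral_map hsample.aemeasurable hFm.aestronglyMeasurable]
  simp only [pulledArm_eq hA]
  exact h1

end Regret

end RobustBandit

open RobustBandit in
theorem theorem1 {Ω : Type*} [MeasurableSpace Ω] (P : Measure Ω) [IsProbabilityMeasure P]
    (d K n : ℕ) (L : ℝ) (B : Model d K)
    (hlam : 0 < B.lam) (hσ0 : 0 ≤ B.σ0) (hσ : 0 < B.σ)
    (hx : ∀ t < n, ∀ i, ‖B.x t i‖ ≤ L)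
    (Z : Source d K → Ω → ℝ) (hZ : B.IsRealization P Z)
    (sel : ℕ → (Fin K → ℝ) → Fin K) (hsel : IsArgmaxRule sel) :
    (Integrable (fun ω => B.regret (B.roLinUCB n) sel (fun s => Z s ω) n) P ∧
      ∫ ω, B.regret (B.roLinUCB n) sel (fun s => Z s ω) n ∂P ≤ B.regretBound L n) ∧
    (Integrable (fun ω => B.regret B.roLinTS sel (fun s => Z s ω) n) P ∧
      ∫ ω, B.regret B.roLinTS sel (fun s => Z s ω) n ∂P ≤ B.regretBound L n) :=
  ⟨roLinUCB_regret_le hlam hσ hσ0 hx hsel hZ, roLinTS_regret_le hlam hσ hσ0 hx hsel hZ⟩
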